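/- Let $\{\varepsilon_i\}_{i\in\mathbb Z}$ be i.i.d. real random variables with independent copy $\{\varepsilon_i'\}$, $\mathcal F_k=(\dots,\varepsilon_{k-1},\varepsilon_k)$, and for $k\ge 0$ let $\mathcal F_k^*$ be $\mathcal F_k$ with $\varepsilon_0$ replaced by $\varepsilon_0'$. Write $\|X\|_p=(\mathbb E|X|^p)^{1/p}$ and $t_i=i/n$. Observe $Y_i=\mu(t_i)+e_i$, $i=1,\dots,n$, where the errors are piecewise locally stationary: there are $0=b_0<b_1<\dots<b_{r+1}=1$ and measurable filters $G_0,\dots,G_r$ with $e_i=G_j(t_i,\mathcal F_i)$ if $b_j<t_i\le b_{j+1}$. Let $\iota>8$ and assume: (A1) for some $C>0$, $\|G_j(t,\mathcal F_0)-G_j(s,\mathcal F_0)\|_\iota\le C|t-s|$ for all $0\le j\le r$ and $s,t\in[b_j,b_{j+1}]$; $\mathbb E e_i=0$; and there is a function $\sigma^2:[0,1]\to(0,\infty)$ with $\operatorname{Var}(e_i)=\sigma^2(t_i)$ for $1\le i\le n$ (for every $n$); (A2) $\mu$ is twice differentiable on $[0,1]$ with Lipschitz continuous second derivative; (A3) $\max_{0\le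 j\le r}\sup_{t\in(b_j,b_{j+1}]}\|G_j(t,\mathcal F_0)\|_\iota<\infty$; (A4) for some $\chi\in(0,1)$, $\max_{0\le j\le r}\sup_{t\in(b_j,b_{j+1}]}\|G_j(t,\mathcal F_k)-G_j(t,\mathcal F_k^*)\|_\iota=O(\chi^k)$. Let $\zeta>0$ and $\tilde t_v\in[\zeta,1-\zeta]$ (in particular $\tilde t_v<1$). Suppose that $\sigma^2$ has a jump at $\tilde t_v$, i.e. its one-sided limits there exist and differ, and that on each of $(0,\tilde t_v)$ and $(\tilde t_v,1)$ it is twice differentiable with Lipschitz continuous second derivative. Let the kernel $K$ be symmetric, supported in $[-1,1]$, twice continuously differentiable on $[-1,1]$, with $\int K=1$, and let the bandwidths $b_n$ satisfy $nb_n^6\to0$ and $nb_n^3\to\infty$. Let $\hat\mu_{b_n}(t)$ be the local linear estimator, i.e. the first component of a minimiser $(c_0,c_1)$ of $$\sum_{i=1}^n\bigl(Y_i-c_0-c_1(t_i-t)\bigr)^2K\Bigl(\frac{t_i-t}{b_n}\Bigr),$$ a minimiser being assumed to exist, for all large $n$, at $t=t_1,\dots,t_n$ (this is automatic if $K\ge0$),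 and put $\hat e_i=Y_i-\hat\mu_{b_n}(t_i)$ for $1\le i\le n$ and $\hat e_i=0$ for other $i$. Let $L=\lfloor n^\alpha\rfloor$ with $4/\iota<\alpha<1/2$, $$\mathcal M(i)=\frac1L\Bigl(\sum_{j=i-L+1}^{i}\hat e_j^2-\sum_{j=i}^{i+L-1}\hat e_j^2\Bigr),$$ let $k_n^*$ be any maximiser of $|\mathcal M(i)|$ over $\lfloor n\zeta\rfloor\le i\le n-\lfloor n\zeta\rfloor+1$, and let $t_n^*=k_n^*/n$. Then $$t_n^*-\tilde t_v=O_p\bigl(n^{-(1-\alpha)}\bigr).$$ -/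

import Mathlib

open MeasureTheory ProbabilityTheory Filter Topology
open scoped ENNReal NNReal

noncomputable section

namespace PLS

variable {Ω : Type*} [MeasurableSpace Ω]

/-- `X n = O_p(a n)`: for every `ε > 0` there is `M` with `P(|X n| > M a n) ≤ ε` for all
large `n`. (`P` is used as an outer measure, so no measurability of `X n` is needed.) -/
def IsBigOp (P : Measure Ω) (X : ℕ → Ω → ℝ) (a : ℕ → ℝ) : Prop :=
  ∀ ε : ℝ, 0 < ε → ∃ M : ℝ, 0 < M ∧
    ∀ᶠ n in atTop, P {ω | M * a n < |X n ω|} ≤ ENNReal.ofReal ε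

/-- `f` is twice differentiable on `s` with Lipschitz continuous second derivative
(derivatives are relative to `s`, i.e. one-sided at an end point that belongs to `s`). -/
def HasLipschitzSecondDeriv (f : ℝ → ℝ) (s : Set ℝ) : Prop :=
  DifferentiableOn ℝ f s ∧ DifferentiableOn ℝ (derivWithin f s) s ∧
    ∃ C : ℝ≥0, LipschitzOnWith C (derivWithin (derivWithin f s) s) s

/-- `f` has a jump at `t`: both one-sided limits exist and they differ. -/
def HasJumpAt (f : ℝ → ℝ) (t : ℝ) : Prop :=
  ∃ l r : ℝ, l ≠ r ∧ Tendsto f (𝓝[<] t) (𝓝 l) ∧ Tendsto f (𝓝[>] t) (𝓝 r)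

/-! ### Innovations and physical dependence -/

/-- `ε` is an i.i.d. sequence and `ε'` is an independent copy of it. -/
structure IsInnovation (P : Measure Ω) (ε ε' : ℤ → Ω → ℝ) : Prop where
  meas : ∀ i, Measurable (ε i)
  meas' : ∀ i, Measurable (ε' i)
  indep : iIndepFun (Sum.elim ε ε') P
  ident : ∀ i, IdentDistrib (ε i) (ε 0) P P
  ident' : ∀ i, IdentDistrib (ε' i) (ε 0) P P

/-- The history `ℱ_k = (ε_k, ε_{k-1}, ε_{k-2}, …)`. -/
def past (ε : ℤ → Ω → ℝ) (k : ℤ) (ω : Ω) : ℕ → ℝ := fun m => ε (k - m) ω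

/-- The history `ℱ_k^*`: as `ℱ_k`, with `ε_0` replaced by `ε'_0`. -/
def pastStar (ε ε' : ℤ → Ω → ℝ) (k : ℤ) (ω : Ω) : ℕ → ℝ :=
  fun m => if k - m = 0 then ε' 0 ω else ε (k - m) ω

/-- The `k`-th physical dependence measure in the `L^p` norm,
`max_j sup_{b_j < t ≤ b_{j+1}} ‖G_j(t, ℱ_k) - G_j(t, ℱ_k^*)‖_p`. -/
def physDep (P : Measure Ω) (ε ε' : ℤ → Ω → ℝ) {r : ℕ} (brk : Fin (r + 2) → ℝ)
    (G : Fin (r + 1) → ℝ → (ℕ → ℝ) → ℝ) (p : ℝ≥0∞) (k : ℤ) : ℝ≥0∞ :=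
  ⨆ j : Fin (r + 1), ⨆ t ∈ Set.Ioc (brk j.castSucc) (brk j.succ),
    eLpNorm (fun ω => G j t (past ε k ω) - G j t (pastStar ε ε' k ω)) p P

/-- The triangular array `e n i` (`1 ≤ i ≤ n`) is piecewise locally stationary, with break points
`0 = brk 0 < brk 1 < ⋯ < brk (r+1) = 1` and filters `G 0, …, G r`. -/
structure IsPLS (ε : ℤ → Ω → ℝ) {r : ℕ} (brk : Fin (r + 2) → ℝ)
    (G : Fin (r + 1) → ℝ → (ℕ → ℝ) → ℝ) (e : ℕ → ℕ → Ω → ℝ) : Prop where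
  brk_zero : brk 0 = 0
  brk_last : brk (Fin.last (r + 1)) = 1
  brk_mono : StrictMono brk
  meas : ∀ j, ∀ t ∈ Set.Icc (brk j.castSucc) (brk j.succ), Measurable (G j t)
  eq : ∀ n i : ℕ, 1 ≤ i → i ≤ n → ∀ j : Fin (r + 1),
    (i : ℝ) / n ∈ Set.Ioc (brk j.castSucc) (brk j.succ) →
      ∀ ω, e n i ω = G j ((i : ℝ) / n) (past ε i ω)

/-- Piecewise stochastic Lipschitz continuity in the `L^p` norm. -/
def IsStochLipschitz (P : Measure Ω) (ε : ℤ → Ω → ℝ) {r : ℕ} (brk : Fin (r + 2) → ℝ)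
    (G : Fin (r + 1) → ℝ → (ℕ → ℝ) → ℝ) (p : ℝ≥0∞) : Prop :=
  ∃ C : ℝ, 0 < C ∧ ∀ j : Fin (r + 1),
    ∀ t ∈ Set.Icc (brk j.castSucc) (brk j.succ),
    ∀ s ∈ Set.Icc (brk j.castSucc) (brk j.succ),
      eLpNorm (fun ω => G j t (past ε 0 ω) - G j s (past ε 0 ω)) p P
        ≤ ENNReal.ofReal (C * |t - s|)

/-- The errors are centred and have the strictly positive variance function `v = σ²`. -/
structure HasVarianceFunction (P : Measure Ω) (e : ℕ → ℕ → Ω → ℝ) (v : ℝ → ℝ) : Prop where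
  mean_zero : ∀ n i : ℕ, 1 ≤ i → i ≤ n → ∫ ω, e n i ω ∂P = 0
  pos : ∀ t ∈ Set.Icc (0 : ℝ) 1, 0 < v t
  var_eq : ∀ n i : ℕ, 1 ≤ i → i ≤ n → variance (e n i) P = v ((i : ℝ) / n)

/-- `max_j sup_{b_j < t ≤ b_{j+1}} ‖G_j(t, ℱ_0)‖_p < ∞`. -/
def HasBoundedMoments (P : Measure Ω) (ε : ℤ → Ω → ℝ) {r : ℕ} (brk : Fin (r + 2) → ℝ)
    (G : Fin (r + 1) → ℝ → (ℕ → ℝ) → ℝ) (p : ℝ≥0∞) : Prop :=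
  (⨆ j : Fin (r + 1), ⨆ t ∈ Set.Ioc (brk j.castSucc) (brk j.succ),
    eLpNorm (fun ω => G j t (past ε 0 ω)) p P) < ∞

/-- Geometric decay `δ_p(k) = O(χ^k)` of the physical dependence measure, for some `χ ∈ (0,1)`. -/
def HasGeometricDependence (P : Measure Ω) (ε ε' : ℤ → Ω → ℝ) {r : ℕ} (brk : Fin (r + 2) → ℝ)
    (G : Fin (r + 1) → ℝ → (ℕ → ℝ) → ℝ) (p : ℝ≥0∞) : Prop :=
  ∃ χ : ℝ, 0 < χ ∧ χ < 1 ∧ ∃ C : ℝ, ∀ k : ℕ, 0 < k →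
    physDep P ε ε' brk G p k ≤ ENNReal.ofReal (C * χ ^ k)

/-! ### The estimators -/

/-- Kernel functions: symmetric, supported in `[-1,1]`, twice continuously differentiable on
`[-1,1]`, with integral one. -/
structure IsKernel (K : ℝ → ℝ) : Prop where
  symm : ∀ x, K (-x) = K x
  supp : Function.support K ⊆ Set.Icc (-1) 1
  smooth : ContDiffOn ℝ 2 K (Set.Icc (-1) 1)
  integral_eq : ∫ x, K x = 1

/-- The local linear least squares criterion at the point `t` for data `y 1, …, y n` observed at
`1/n, …, n/n`, with bandwidth `b`, intercept `c₀` and slope `c₁`. -/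
def localLinearLoss (K : ℝ → ℝ) (b : ℝ) (n : ℕ) (y : ℕ → ℝ) (t c₀ c₁ : ℝ) : ℝ :=
  ∑ i ∈ Finset.Icc 1 n,
    (y i - c₀ - c₁ * ((i : ℝ) / n - t)) ^ 2 * K (((i : ℝ) / n - t) / b)

/-- `m` is the first component of a minimiser of the local linear criterion at `t`. -/
def IsLocalLinearEstimate (K : ℝ → ℝ) (b : ℝ) (n : ℕ) (y : ℕ → ℝ) (t m : ℝ) : Prop :=
  ∃ d : ℝ, ∀ c₀ c₁ : ℝ,
    localLinearLoss K b n y t m d ≤ localLinearLoss K b n y t c₀ c₁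

/-- Residuals `y j - m (j/n)` for `1 ≤ j ≤ n`, with the value `0` for other indices. -/
def residual (n : ℕ) (y : ℕ → ℝ) (m : ℝ → ℝ) (j : ℕ) : ℝ :=
  if 1 ≤ j ∧ j ≤ n then y j - m ((j : ℝ) / n) else 0

/-- The moving window statistic
`L⁻¹ (∑_{j=i-L+1}^{i} u_j² - ∑_{j=i}^{i+L-1} u_j²)`. When `i - L + 1 < 0` the first sum starts
at `0`, in accordance with the convention that residuals outside `1, …, n` vanish. -/
def windowStat (L : ℕ) (u : ℕ → ℝ) (i : ℕ) : ℝ :=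
  (1 / (L : ℝ)) *
    (∑ j ∈ Finset.Icc (i + 1 - L) i, u j ^ 2 - ∑ j ∈ Finset.Icc i (i + L - 1), u j ^ 2)

/-- `k` maximises `|windowStat L u i|` over `⌊nζ⌋ ≤ i ≤ n - ⌊nζ⌋ + 1`. -/
def IsWindowArgmax (ζ : ℝ) (n L : ℕ) (u : ℕ → ℝ) (k : ℕ) : Prop :=
  k ∈ Set.Icc ⌊(n : ℝ) * ζ⌋₊ (n - ⌊(n : ℝ) * ζ⌋₊ + 1) ∧
    IsMaxOn (fun i => |windowStat L u i|)
      (Set.Icc ⌊(n : ℝ) * ζ⌋₊ (n - ⌊(n : ℝ) * ζ⌋₊ + 1)) k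

end PLS

end

/-!
The statistic compares the average of the squared residuals over the `L` indices before `i` with
the average over the `L` indices after `i`. The theorem follows once these window averages are, with
probability tending to one and uniformly over all windows away from the end points, close to the
averages of the variance function `v`. Indeed, if both windows lie on one side of the jump, then
the statistic is close to zero by the uniform continuity of `v` there, whereas at the jump it is
close to the jump size. Hence every maximiser is at distance less than `L ≤ n ^ α` from `n * tv`
(`PLS.abs_argmax_sub_lt`), and the rate `n ^ (-(1 - α))` holds with constant one.

Uniform closeness (`PLS.IsPLS.tendsto_measure_window_residual`) has two ingredients.

* Squared errors. For `X = g (past ε a)` the differences of the conditional expectations of `X`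
  given the innovations from time `a - m` on, and from time `a - m + 1` on, are reversed martingale
  differences in `a` for each fixed lag `m`, and their `L^p` norms are at most twice the physical
  dependence measure of lag `m`. A moment inequality of order `2 * k + 2` for such differences,
  summation over `m` and Lévy's upward theorem give a bound of order `√N` for the `L^(2 * k + 2)`
  norm of a centred sum of `N` terms (`PLS.IsInnovation.eLpNorm_sum_sub_integral_le`). No tail
  triviality is needed, since conditioning runs from the present into the past. With `ι` moments
  of the errors one can take `k + 2 > ι / 4`, so that `1 < α * (k + 2)`. This is what a union bound
  over intervals starting at multiples of `L / R` needs, and positivity of the squares extends it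
  from these intervals to all windows.
* Estimation of the mean. At a design point in the interior the symmetry of the kernel annihilates
  the coefficient of the slope in the normal equation of the intercept, so the local linear estimate
  is a kernel average of the observations even if the kernel takes negative values. Continuity
  of the mean function makes the bias small, and fourth moments of the kernel sums with a union
  bound over the `n` design points make the stochastic part uniformly small.
-/

noncomputable section

namespace PLS

/-! ### Moments of sums of reversed martingale differences -/

section ReversedMartingale

lemma pow_mul_sq_le_div_add (a b : ℝ) (k : ℕ) {N : ℝ} (hN : 1 ≤ N) :
    a ^ (2 * k) * b ^ 2 ≤ a ^ (2 * k + 2) / N + N ^ k * b ^ (2 * k + 2) := by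
  have hN0 : 0 < N := by linarith
  have hb : 0 ≤ b ^ (2 * k + 2) := Even.pow_nonneg ⟨k + 1, by ring⟩ b
  have ha : 0 ≤ a ^ (2 * k + 2) := Even.pow_nonneg ⟨k + 1, by ring⟩ a
  have ha' : 0 ≤ a ^ (2 * k) := Even.pow_nonneg ⟨k, by ring⟩ a
  rcases le_total (b ^ 2) (a ^ 2 / N) with h | h
  · have h1 : a ^ (2 * k) * b ^ 2 ≤ a ^ (2 * k + 2) / N := by
      calc a ^ (2 * k) * b ^ 2 ≤ a ^ (2 * k) * (a ^ 2 / N) := by gcongr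
        _ = a ^ (2 * k + 2) / N := by ring
    have : 0 ≤ N ^ k * b ^ (2 * k + 2) := by positivity
    linarith
  · have h2 : a ^ 2 ≤ N * b ^ 2 := by
      rw [div_le_iff₀ hN0] at h; linarith
    have h1 : a ^ (2 * k) * b ^ 2 ≤ N ^ k * b ^ (2 * k + 2) := by
      calc a ^ (2 * k) * b ^ 2 = (a ^ 2) ^ k * b ^ 2 := by ring
        _ ≤ (N * b ^ 2) ^ k * b ^ 2 := by gcongr
        _ = N ^ k * b ^ (2 * k + 2) := by ring
    have : 0 ≤ a ^ (2 * k + 2) / N := by positivity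
    linarith

lemma pow_mul_pow_le_pow_mul_sq_add (a b : ℝ) {k i : ℕ} (hi : i ≤ 2 * k) :
    a ^ i * b ^ (2 * k + 2 - i) ≤ a ^ (2 * k) * b ^ 2 + b ^ (2 * k + 2) := by
  have hb : 0 ≤ b ^ (2 * k + 2) := Even.pow_nonneg ⟨k + 1, by ring⟩ b
  have ha' : 0 ≤ a ^ (2 * k) := Even.pow_nonneg ⟨k, by ring⟩ a
  have e1 : a ^ (2 * k) = |a| ^ (2 * k) := (Even.pow_abs ⟨k, by ring⟩ a).symm
  have e2 : b ^ (2 * k + 2) = |b| ^ (2 * k + 2) := (Even.pow_abs ⟨k + 1, by ring⟩ b).symm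
  have e3 : b ^ 2 = |b| ^ 2 := (sq_abs b).symm
  have h0 : a ^ i * b ^ (2 * k + 2 - i) ≤ |a| ^ i * |b| ^ (2 * k + 2 - i) := by
    refine (le_abs_self _).trans ?_
    rw [abs_mul, abs_pow, abs_pow]
  refine h0.trans ?_
  rcases le_total |a| |b| with h | h
  · have : |a| ^ i * |b| ^ (2 * k + 2 - i) ≤ b ^ (2 * k + 2) := by
      calc |a| ^ i * |b| ^ (2 * k + 2 - i) ≤ |b| ^ i * |b| ^ (2 * k + 2 - i) := by gcongr
        _ = b ^ (2 * k + 2) := by rw [← pow_add, e2]; congr 1; omega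
    have : 0 ≤ a ^ (2 * k) * b ^ 2 := by positivity
    linarith
  · have : |a| ^ i * |b| ^ (2 * k + 2 - i) ≤ a ^ (2 * k) * b ^ 2 := by
      calc |a| ^ i * |b| ^ (2 * k + 2 - i) = |a| ^ i * |b| ^ (2 * k - i) * |b| ^ 2 := by
            rw [mul_assoc, ← pow_add]; congr 2; omega
        _ ≤ |a| ^ i * |a| ^ (2 * k - i) * |b| ^ 2 := by gcongr
        _ = a ^ (2 * k) * b ^ 2 := by rw [← pow_add, e1, e3]; congr 2; omega
    linarith

/-- A binomial expansion in which only the term linear in `b` is kept. The weight `1 / N` of the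
leading power lets the bound be iterated `N` times at the cost of a constant factor. -/
lemma add_pow_le_of_one_le (a b : ℝ) (k : ℕ) {N : ℝ} (hN : 1 ≤ N) :
    (a + b) ^ (2 * k + 2) ≤ (1 + 4 ^ (k + 1) / N) * a ^ (2 * k + 2)
      + (2 * k + 2) * (a ^ (2 * k + 1) * b) + 2 * 4 ^ (k + 1) * N ^ k * b ^ (2 * k + 2) := by
  have hN0 : 0 < N := by linarith
  have hb : 0 ≤ b ^ (2 * k + 2) := Even.pow_nonneg ⟨k + 1, by ring⟩ b
  have ha : 0 ≤ a ^ (2 * k + 2) := Even.pow_nonneg ⟨k + 1, by ring⟩ a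
  set R := a ^ (2 * k + 2) / N + 2 * N ^ k * b ^ (2 * k + 2) with hR
  have hR0 : 0 ≤ R := by positivity
  have hterm : ∀ i ∈ Finset.range (2 * k + 1),
      a ^ i * b ^ (2 * k + 2 - i) * ((2 * k + 2).choose i : ℝ) ≤
        R * ((2 * k + 2).choose i : ℝ) := by
    intro i hi
    have hi' : i ≤ 2 * k := by rw [Finset.mem_range] at hi; omega
    gcongr
    have h1 := pow_mul_pow_le_pow_mul_sq_add a b hi'
    have h2 := pow_mul_sq_le_div_add a b k hN
    have h3 : b ^ (2 * k + 2) ≤ N ^ k * b ^ (2 * k + 2) :=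
      le_mul_of_one_le_left hb (one_le_pow₀ hN)
    rw [hR]; linarith
  have hchoose : ∑ i ∈ Finset.range (2 * k + 1), ((2 * k + 2).choose i : ℝ) ≤ 4 ^ (k + 1) := by
    have h := Nat.sum_range_choose (2 * k + 2)
    have h' : ∑ i ∈ Finset.range (2 * k + 2 + 1), ((2 * k + 2).choose i : ℝ) = 4 ^ (k + 1) := by
      rw [← Nat.cast_sum, h]; push_cast
      rw [show 2 * k + 2 = 2 * (k + 1) by ring, pow_mul]; norm_num
    rw [← h']
    exact Finset.sum_le_sum_of_subset_of_nonneg (Finset.range_mono (by omega))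
      (fun _ _ _ => by positivity)
  rw [add_pow, Finset.sum_range_succ, Finset.sum_range_succ]
  have hs : ∑ i ∈ Finset.range (2 * k + 1),
      a ^ i * b ^ (2 * k + 2 - i) * ((2 * k + 2).choose i : ℝ) ≤ R * 4 ^ (k + 1) := by
    refine (Finset.sum_le_sum hterm).trans ?_
    rw [← Finset.mul_sum]; gcongr
  have hc1 : ((2 * k + 2).choose (2 * k + 1) : ℝ) = 2 * k + 2 := by
    rw [Nat.choose_succ_self_right]; push_cast; ring
  rw [hc1, show 2 * k + 2 - (2 * k + 1) = 1 by omega, Nat.choose_self, Nat.sub_self]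
  have : R * 4 ^ (k + 1) = 4 ^ (k + 1) / N * a ^ (2 * k + 2)
      + 2 * 4 ^ (k + 1) * N ^ k * b ^ (2 * k + 2) := by rw [hR]; ring
  rw [this] at hs
  simp only [pow_one, pow_zero, mul_one, Nat.cast_one]
  linarith

variable {Ω : Type*} [MeasurableSpace Ω]

lemma integrable_even_pow {P : Measure Ω} {f : Ω → ℝ} {k : ℕ}
    (hf : MemLp f ((2 * k + 2 : ℕ) : ℝ≥0∞) P) : Integrable (fun ω => f ω ^ (2 * k + 2)) P := by
  have := hf.integrable_norm_pow (by omega)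
  refine this.congr (ae_of_all _ fun ω => ?_)
  simp only [Real.norm_eq_abs]
  exact Even.pow_abs ⟨k + 1, by ring⟩ _

lemma eLpNorm_le_ofReal_iff_integral_pow_le {P : Measure Ω} {f : Ω → ℝ} {k : ℕ}
    (hf : MemLp f ((2 * k + 2 : ℕ) : ℝ≥0∞) P) {D : ℝ} (hD : 0 ≤ D) :
    eLpNorm f ((2 * k + 2 : ℕ) : ℝ≥0∞) P ≤ ENNReal.ofReal D ↔
      ∫ ω, f ω ^ (2 * k + 2) ∂P ≤ D ^ (2 * k + 2) := by
  rw [hf.eLpNorm_eq_integral_rpow_norm (by simp) (ENNReal.natCast_ne_top _), ENNReal.toReal_natCast,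
    ENNReal.ofReal_le_ofReal_iff hD]
  have h1 : ∫ ω, ‖f ω‖ ^ ((2 * k + 2 : ℕ) : ℝ) ∂P = ∫ ω, f ω ^ (2 * k + 2) ∂P := by
    refine integral_congr_ae (ae_of_all _ fun ω => ?_)
    simp only [Real.rpow_natCast, Real.norm_eq_abs]
    exact Even.pow_abs ⟨k + 1, by ring⟩ _
  have h0 : 0 ≤ ∫ ω, f ω ^ (2 * k + 2) ∂P :=
    integral_nonneg fun ω => Even.pow_nonneg ⟨k + 1, by ring⟩ _
  rw [h1, Real.rpow_inv_le_iff_of_pos h0 hD (by positivity), Real.rpow_natCast]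

/-- The moment of order `2 * k + 2` of a sum of reversed martingale differences: `d x` is
measurable with respect to `𝓗 a` for `x > a`, and `d a` is centred given `𝓗 a`. -/
lemma integral_pow_sum_le {P : Measure Ω} [IsProbabilityMeasure P] (k : ℕ)
    {𝓗 : ℕ → MeasurableSpace Ω} (h𝓗 : ∀ a, 𝓗 a ≤ ‹MeasurableSpace Ω›)
    {d : ℕ → Ω → ℝ} {N D : ℝ} (hN : 1 ≤ N) (hD : 0 ≤ D) (I : Finset ℕ)
    (hmeas : ∀ a ∈ I, ∀ x ∈ I, a < x → StronglyMeasurable[𝓗 a] (d x))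
    (hLp : ∀ a ∈ I, MemLp (d a) ((2 * k + 2 : ℕ) : ℝ≥0∞) P)
    (hzero : ∀ a ∈ I, P[d a | 𝓗 a] =ᵐ[P] 0)
    (hd : ∀ a ∈ I, ∫ ω, d a ω ^ (2 * k + 2) ∂P ≤ D) :
    ∫ ω, (∑ a ∈ I, d a ω) ^ (2 * k + 2) ∂P ≤
      (1 + 4 ^ (k + 1) / N) ^ I.card * (I.card * (2 * 4 ^ (k + 1) * N ^ k * D)) := by
  have hN0 : 0 < N := by linarith
  induction I using Finset.induction_on_min with
  | empty => simp
  | insert a s has ih =>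
    have has' : a ∉ s := fun h => lt_irrefl _ (has a h)
    have ih' := ih (fun x hx y hy => hmeas x (by simp [hx]) y (by simp [hy]))
      (fun x hx => hLp x (by simp [hx])) (fun x hx => hzero x (by simp [hx]))
      (fun x hx => hd x (by simp [hx]))
    set S : Ω → ℝ := fun ω => ∑ x ∈ s, d x ω with hS
    have hda := hLp a (by simp)
    have hSLp : MemLp S ((2 * k + 2 : ℕ) : ℝ≥0∞) P :=
      memLp_finsetSum s fun x hx => hLp x (by simp [hx])
    have hSm : StronglyMeasurable[𝓗 a] S :=
      Finset.stronglyMeasurable_fun_sum s fun x hx => hmeas a (by simp) x (by simp [hx]) (has x hx)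
    have hSi := integrable_even_pow hSLp
    have hdi := integrable_even_pow hda
    -- `|S| ^ (2 * k + 1) * |d a|` is dominated by the larger of the two even powers
    have hcross : Integrable (fun ω => S ω ^ (2 * k + 1) * d a ω) P := by
      refine (hSi.add hdi).mono' ?_ (ae_of_all _ fun ω => ?_)
      · exact (hSLp.1.pow _).mul hda.1
      · have e1 : S ω ^ (2 * k + 2) = |S ω| ^ (2 * k + 2) :=
          (Even.pow_abs ⟨k + 1, by ring⟩ _).symm
        have e2 : d a ω ^ (2 * k + 2) = |d a ω| ^ (2 * k + 2) :=
          (Even.pow_abs ⟨k + 1, by ring⟩ _).symm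
        simp only [Pi.add_apply, norm_mul, norm_pow, Real.norm_eq_abs]
        rw [e1, e2]
        rcases le_total |S ω| |d a ω| with h | h
        · calc |S ω| ^ (2 * k + 1) * |d a ω| ≤ |d a ω| ^ (2 * k + 1) * |d a ω| := by gcongr
            _ = |d a ω| ^ (2 * k + 2) := by ring
            _ ≤ _ := le_add_of_nonneg_left (by positivity)
        · calc |S ω| ^ (2 * k + 1) * |d a ω| ≤ |S ω| ^ (2 * k + 1) * |S ω| := by gcongr
            _ = |S ω| ^ (2 * k + 2) := by ring
            _ ≤ _ := le_add_of_nonneg_right (by positivity)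
    have hcross0 : ∫ ω, S ω ^ (2 * k + 1) * d a ω ∂P = 0 := by
      have h1 := condExp_mul_of_stronglyMeasurable_left (μ := P) (m := 𝓗 a)
        (f := fun ω => S ω ^ (2 * k + 1)) (g := d a) (hSm.pow _) hcross
        (hda.integrable (by norm_cast; omega))
      rw [← integral_condExp (h𝓗 a)]
      have h2 : P[fun ω => S ω ^ (2 * k + 1) * d a ω | 𝓗 a] =ᵐ[P] 0 := by
        refine EventuallyEq.trans h1 ?_
        filter_upwards [hzero a (by simp)] with ω hω
        simp [hω]
      rw [integral_congr_ae h2]; simp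
    have hmono : ∫ ω, (∑ x ∈ insert a s, d x ω) ^ (2 * k + 2) ∂P ≤
        ∫ ω, ((1 + 4 ^ (k + 1) / N) * S ω ^ (2 * k + 2)
          + (2 * k + 2) * (S ω ^ (2 * k + 1) * d a ω)
          + 2 * 4 ^ (k + 1) * N ^ k * d a ω ^ (2 * k + 2)) ∂P := by
      refine integral_mono_of_nonneg (ae_of_all _ fun ω => Even.pow_nonneg ⟨k + 1, by ring⟩ _)
        (((hSi.const_mul _).add (hcross.const_mul _)).add (hdi.const_mul _))
        (ae_of_all _ fun ω => ?_)
      simp only [Finset.sum_insert has']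
      rw [add_comm (d a ω)]
      exact add_pow_le_of_one_le _ _ k hN
    refine hmono.trans ?_
    have hsum : Integrable (fun ω => (1 + 4 ^ (k + 1) / N) * S ω ^ (2 * k + 2)
        + (2 * k + 2) * (S ω ^ (2 * k + 1) * d a ω)) P :=
      (hSi.const_mul _).add (hcross.const_mul _)
    rw [integral_add hsum (hdi.const_mul _), integral_add (hSi.const_mul _) (hcross.const_mul _),
      integral_const_mul, integral_const_mul, integral_const_mul, hcross0, mul_zero, add_zero,
      Finset.card_insert_of_notMem has']
    set c : ℝ := 1 + 4 ^ (k + 1) / N with hc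
    set E : ℝ := 2 * 4 ^ (k + 1) * N ^ k with hE
    have hc1 : 1 ≤ c := by rw [hc]; exact le_add_of_nonneg_right (by positivity)
    have hE0 : 0 ≤ E := by positivity
    have h3 : E * ∫ ω, d a ω ^ (2 * k + 2) ∂P ≤ E * D := by
      gcongr; exact hd a (by simp)
    have h4 : c * ∫ ω, S ω ^ (2 * k + 2) ∂P ≤ c * (c ^ s.card * (s.card * (E * D))) := by
      gcongr
    have h5 : E * D ≤ c ^ (s.card + 1) * (E * D) :=
      le_mul_of_one_le_left (by positivity) (one_le_pow₀ hc1)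
    calc _ ≤ c * (c ^ s.card * (s.card * (E * D))) + c ^ (s.card + 1) * (E * D) := by linarith
      _ = _ := by push_cast; ring

/-- The constant in the moment inequality for sums of reversed martingale differences. -/
def momentConst (k : ℕ) : ℝ := Real.exp (4 ^ (k + 1)) * (2 * 4 ^ (k + 1))

lemma one_le_momentConst (k : ℕ) : 1 ≤ momentConst k := by
  have h1 : 1 ≤ Real.exp (4 ^ (k + 1)) := Real.one_le_exp (by positivity)
  have h2 : (1 : ℝ) ≤ 4 ^ (k + 1) := one_le_pow₀ (by norm_num)
  unfold momentConst
  nlinarith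

/-- A sum of at most `N` reversed martingale differences is of order `√N` in `L^(2 * k + 2)`. -/
lemma eLpNorm_sum_le_of_reversedMartingale {P : Measure Ω} [IsProbabilityMeasure P] (k : ℕ)
    {𝓗 : ℕ → MeasurableSpace Ω} (h𝓗 : ∀ a, 𝓗 a ≤ ‹MeasurableSpace Ω›)
    {d : ℕ → Ω → ℝ} {N D : ℝ} (hN : 1 ≤ N) (hD : 0 ≤ D) (I : Finset ℕ) (hI : (I.card : ℝ) ≤ N)
    (hmeas : ∀ a ∈ I, ∀ x ∈ I, a < x → StronglyMeasurable[𝓗 a] (d x))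
    (hLp : ∀ a ∈ I, MemLp (d a) ((2 * k + 2 : ℕ) : ℝ≥0∞) P)
    (hzero : ∀ a ∈ I, P[d a | 𝓗 a] =ᵐ[P] 0)
    (hd : ∀ a ∈ I, eLpNorm (d a) ((2 * k + 2 : ℕ) : ℝ≥0∞) P ≤ ENNReal.ofReal D) :
    eLpNorm (fun ω => ∑ a ∈ I, d a ω) ((2 * k + 2 : ℕ) : ℝ≥0∞) P ≤
      ENNReal.ofReal (momentConst k * √N * D) := by
  have hB := one_le_momentConst k
  rw [eLpNorm_le_ofReal_iff_integral_pow_le (memLp_finsetSum I hLp) (by positivity)]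
  have h1 := integral_pow_sum_le k h𝓗 hN (pow_nonneg hD (2 * k + 2)) I hmeas hLp hzero
    (fun a ha => (eLpNorm_le_ofReal_iff_integral_pow_le (hLp a ha) hD).1 (hd a ha))
  refine h1.trans ?_
  have hN0 : 0 < N := by linarith
  have h2 : (1 + 4 ^ (k + 1) / N) ^ I.card ≤ Real.exp (4 ^ (k + 1)) := by
    calc (1 + 4 ^ (k + 1) / N) ^ I.card ≤ Real.exp (4 ^ (k + 1) / N) ^ I.card := by
          gcongr; rw [add_comm]; exact Real.add_one_le_exp _
      _ = Real.exp (I.card * (4 ^ (k + 1) / N)) := (Real.exp_nat_mul _ _).symm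
      _ ≤ Real.exp (N * (4 ^ (k + 1) / N)) := by gcongr
      _ = _ := by congr 1; field_simp
  have h3 : √N ^ (2 * k + 2) = N ^ (k + 1) := by
    rw [show 2 * k + 2 = 2 * (k + 1) by ring, pow_mul, Real.sq_sqrt hN0.le]
  calc (1 + 4 ^ (k + 1) / N) ^ I.card * (I.card * (2 * 4 ^ (k + 1) * N ^ k * D ^ (2 * k + 2)))
      ≤ Real.exp (4 ^ (k + 1)) * (N * (2 * 4 ^ (k + 1) * N ^ k * D ^ (2 * k + 2))) := by
        gcongr
    _ = momentConst k * N ^ (k + 1) * D ^ (2 * k + 2) := by unfold momentConst; ring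
    _ ≤ momentConst k ^ (2 * k + 2) * N ^ (k + 1) * D ^ (2 * k + 2) := by
        gcongr; exact le_self_pow₀ hB (by omega)
    _ = _ := by rw [mul_pow, mul_pow, h3]

end ReversedMartingale

/-! ### Innovations and physical dependence in reversed time -/

section ConditionalExpectation

variable {Ω : Type*}

/-- The integral of a function over an event independent of it factorizes. -/
lemma setIntegral_of_indep {m₀ m₁ m₂ : MeasurableSpace Ω} {P : Measure[m₀] Ω}
    [IsProbabilityMeasure P] (h₁ : m₁ ≤ m₀) (h₂ : m₂ ≤ m₀) (hind : Indep m₁ m₂ P) {f : Ω → ℝ}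
    (hf : StronglyMeasurable[m₁] f) (hfi : Integrable f P) {B : Set Ω}
    (hB : MeasurableSet[m₂] B) : ∫ ω in B, f ω ∂P = P.real B * ∫ ω, f ω ∂P := by
  rw [← setIntegral_condExp h₂ hfi hB,
    setIntegral_congr_ae (g := fun _ => ∫ ω, f ω ∂P) (h₂ _ hB)
      ((condExp_indep_eq h₁ h₂ hf hind).mono fun ω h _ => h), setIntegral_const, smul_eq_mul]

/-- Enlarging the conditioning σ-algebra by independent information does not change a conditional
expectation. -/
lemma condExp_sup_of_indep {m₀ m₁ m₂ m' : MeasurableSpace Ω} {P : Measure[m₀] Ω}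
    [IsProbabilityMeasure P] (h' : m' ≤ m₀) (h₁ : m₁ ≤ m') (h₂ : m₂ ≤ m₀) (hind : Indep m' m₂ P)
    {f : Ω → ℝ} (hf : StronglyMeasurable[m'] f) (hfi : Integrable f P) :
    P[f | m₁ ⊔ m₂] =ᵐ[P] P[f | m₁] := by
  have hle : m₁ ⊔ m₂ ≤ m₀ := sup_le (h₁.trans h') h₂
  have hm₁ : m₁ ≤ m₀ := h₁.trans h'
  set g := P[f | m₁] with hg
  have hgi : Integrable g P := integrable_condExp
  have hgm : StronglyMeasurable[m₁] g := stronglyMeasurable_condExp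
  symm
  refine ae_eq_condExp_of_forall_setIntegral_eq hle hfi (fun s _ _ => hgi.integrableOn) ?_
    (hgm.mono (le_sup_left : m₁ ≤ m₁ ⊔ m₂)).aestronglyMeasurable
  intro s hs _
  -- the intersections of events from both σ-algebras are a π-system which generates the supremum
  let π : Set (Set Ω) := {t | ∃ A B, MeasurableSet[m₁] A ∧ MeasurableSet[m₂] B ∧ t = A ∩ B}
  have hπ : IsPiSystem π := by
    rintro _ ⟨A, B, hA, hB, rfl⟩ _ ⟨A', B', hA', hB', rfl⟩ _
    refine ⟨A ∩ A', B ∩ B', ?_, ?_, Set.inter_inter_inter_comm _ _ _ _⟩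
    · exact MeasurableSet.inter hA hA'
    · exact MeasurableSet.inter hB hB'
  have hgen : m₁ ⊔ m₂ = MeasurableSpace.generateFrom π := by
    apply le_antisymm
    · refine sup_le (fun A hA => ?_) (fun B hB => ?_)
      · exact MeasurableSpace.measurableSet_generateFrom
          ⟨A, Set.univ, hA, @MeasurableSet.univ _ m₂, by simp⟩
      · exact MeasurableSpace.measurableSet_generateFrom
          ⟨Set.univ, B, @MeasurableSet.univ _ m₁, hB, by simp⟩
    · refine MeasurableSpace.generateFrom_le ?_
      rintro _ ⟨A, B, hA, hB, rfl⟩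
      exact MeasurableSet.inter ((le_sup_left : m₁ ≤ m₁ ⊔ m₂) _ hA)
        ((le_sup_right : m₂ ≤ m₁ ⊔ m₂) _ hB)
  have huniv : ∫ ω, g ω ∂P = ∫ ω, f ω ∂P := integral_condExp hm₁
  induction s, hs using MeasurableSpace.induction_on_inter hgen hπ with
  | empty => simp
  | basic t ht =>
    obtain ⟨A, B, hA, hB, rfl⟩ := ht
    have key : ∀ u : Ω → ℝ, StronglyMeasurable[m'] u → Integrable u P →
        ∫ ω in A ∩ B, u ω ∂P = P.real B * ∫ ω in A, u ω ∂P := by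
      intro u hu hui
      have h1 := setIntegral_of_indep h' h₂ hind (hu.indicator (h₁ _ hA))
        (hui.indicator (hm₁ _ hA)) hB
      rw [setIntegral_indicator (hm₁ _ hA), integral_indicator (hm₁ _ hA)] at h1
      rw [Set.inter_comm, h1]
    rw [key g (hgm.mono h₁) hgi, key f hf hfi, setIntegral_condExp hm₁ hfi hA]
  | compl t ht ih =>
    have e := ih (measure_lt_top _ _)
    rw [setIntegral_compl (hle _ ht) hgi, setIntegral_compl (hle _ ht) hfi, e, huniv]
  | iUnion F hF hFm ih =>
    rw [integral_iUnion (fun i => hle _ (hFm i)) hF hgi.integrableOn,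
      integral_iUnion (fun i => hle _ (hFm i)) hF hfi.integrableOn]
    exact tsum_congr fun i => ih i (measure_lt_top _ _)

/-- The σ-algebra generated by the innovations `ε a, ε (a + 1), …`. -/
abbrev future (ε : ℤ → Ω → ℝ) (a : ℤ) : MeasurableSpace Ω :=
  ⨆ i ∈ Set.Ici a, MeasurableSpace.comap (ε i) inferInstance

/-- The history at time `k`, with the innovation of lag `m` replaced by `ε' 0`. -/
def pastRepl (ε ε' : ℤ → Ω → ℝ) (k : ℤ) (m : ℕ) (ω : Ω) : ℕ → ℝ :=
  Function.update (past ε k ω) m (ε' 0 ω)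

lemma pastStar_eq_pastRepl (ε ε' : ℤ → Ω → ℝ) (m : ℕ) :
    pastStar ε ε' m = pastRepl ε ε' m m := by
  funext ω i
  unfold pastStar pastRepl past
  by_cases h : i = m
  · subst h; simp
  · have : (m : ℤ) - i ≠ 0 := by omega
    rw [Function.update_of_ne h, if_neg this]


lemma comap_le_future (ε : ℤ → Ω → ℝ) {a i : ℤ} (h : a ≤ i) :
    MeasurableSpace.comap (ε i) inferInstance ≤ future ε a :=
  le_iSup₂_of_le i h le_rfl

lemma future_antitone (ε : ℤ → Ω → ℝ) : Antitone (future ε) := fun _ _ hab =>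
  iSup₂_le fun _ hi => comap_le_future ε (hab.trans hi)

lemma future_eq_sup (ε : ℤ → Ω → ℝ) (a : ℤ) :
    future ε a = future ε (a + 1) ⊔ MeasurableSpace.comap (ε a) inferInstance := by
  apply le_antisymm
  · refine iSup₂_le fun i hi => ?_
    rcases eq_or_lt_of_le (show a ≤ i from hi) with rfl | h
    · exact le_sup_right
    · exact (comap_le_future ε (by omega)).trans le_sup_left
  · exact sup_le (future_antitone ε (by omega)) (comap_le_future ε le_rfl)

/-- The indices of the innovations which enter a history with the innovation of lag `m` replaced. -/
def replIndex (k : ℤ) (m : ℕ) (i : ℕ) : ℤ ⊕ ℤ := if i = m then Sum.inr 0 else Sum.inl (k - i)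

lemma replIndex_injective (k : ℤ) (m : ℕ) : Function.Injective (replIndex k m) := by
  intro i j hij
  unfold replIndex at hij
  split_ifs at hij with h1 h2
  · rw [h1, h2]
  · simp at hij; omega

lemma pastRepl_eq (ε ε' : ℤ → Ω → ℝ) (k : ℤ) (m : ℕ) :
    pastRepl ε ε' k m = fun ω i => Sum.elim ε ε' (replIndex k m i) ω := by
  funext ω i
  unfold pastRepl replIndex past
  by_cases h : i = m
  · subst h; simp
  · simp [h]

section Innovations

variable [MeasurableSpace Ω] {P : Measure Ω} {ε ε' : ℤ → Ω → ℝ}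

lemma IsInnovation.future_le (h : IsInnovation P ε ε') (a : ℤ) :
    future ε a ≤ ‹MeasurableSpace Ω› :=
  iSup₂_le fun i _ => (h.meas i).comap_le

lemma IsInnovation.measurable_past (h : IsInnovation P ε ε') (k : ℤ) : Measurable (past ε k) :=
  measurable_pi_iff.2 fun _ => h.meas _

lemma IsInnovation.measurable_pastRepl (h : IsInnovation P ε ε') (k : ℤ) (m : ℕ) :
    Measurable (pastRepl ε ε' k m) := by
  refine measurable_pi_iff.2 fun i => ?_
  by_cases hi : i = m
  · subst hi; simpa [pastRepl] using h.meas' 0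
  · simpa [pastRepl, Function.update_of_ne hi] using h.measurable_past k |>.eval

lemma IsInnovation.identDistrib_elim (h : IsInnovation P ε ε') (s t : ℤ ⊕ ℤ) :
    IdentDistrib (Sum.elim ε ε' s) (Sum.elim ε ε' t) P P := by
  have key : ∀ s, IdentDistrib (Sum.elim ε ε' s) (ε 0) P P := by
    rintro (i | i)
    · exact h.ident i
    · exact h.ident' i
  exact (key s).trans (key t).symm

/-- The joint law of a countable family of distinct innovations depends on its index set only. -/
lemma IsInnovation.identDistrib_of_injective (h : IsInnovation P ε ε') {κ : Type*} [Countable κ]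
    {f g : κ → ℤ ⊕ ℤ} (hf : Function.Injective f) (hg : Function.Injective g) :
    IdentDistrib (fun ω i => Sum.elim ε ε' (f i) ω) (fun ω i => Sum.elim ε ε' (g i) ω) P P :=
  IdentDistrib.pi (fun i => h.identDistrib_elim (f i) (g i)) (h.indep.precomp hf)
    (h.indep.precomp hg)

lemma IsInnovation.identDistrib_past (h : IsInnovation P ε ε') (k l : ℤ) :
    IdentDistrib (past ε k) (past ε l) P P := by
  have := h.identDistrib_of_injective (f := fun i : ℕ => Sum.inl (k - i))
    (g := fun i : ℕ => Sum.inl (l - i)) (fun i j hij => by simpa using hij)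
    (fun i j hij => by simpa using hij)
  exact this

lemma IsInnovation.identDistrib_pastRepl (h : IsInnovation P ε ε') (k l : ℤ) (m : ℕ) :
    IdentDistrib (pastRepl ε ε' k m) (past ε l) P P := by
  have := h.identDistrib_of_injective (replIndex_injective k m)
    (g := fun i : ℕ => Sum.inl (l - i)) (fun i j hij => by simpa using hij)
  rw [← pastRepl_eq] at this
  exact this

/-- Stationarity of the coupled pair: shifting the time does not change the joint law of a history
and the history with the innovation of lag `m` replaced. -/
lemma IsInnovation.identDistrib_past_pastRepl (h : IsInnovation P ε ε') (k l : ℤ) (m : ℕ) :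
    IdentDistrib (fun ω => (past ε k ω, pastRepl ε ε' k m ω))
      (fun ω => (past ε l ω, pastRepl ε ε' l m ω)) P P := by
  -- both histories are functions of `ε k, ε (k - 1), …` and `ε' 0`, the latter indexed by `none`
  let f : ℤ → Option ℕ → ℤ ⊕ ℤ := fun k o => o.elim (Sum.inr 0) fun i => Sum.inl (k - i)
  have hf : ∀ k, Function.Injective (f k) := by
    rintro k (_ | i) (_ | j) hij <;> simp [f] at hij ⊢
    exact hij
  have h1 := h.identDistrib_of_injective (hf k) (hf l)
  let u : (Option ℕ → ℝ) → (ℕ → ℝ) × (ℕ → ℝ) := fun x =>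
    (fun i => x (some i), Function.update (fun i => x (some i)) m (x none))
  have hu : Measurable u := by
    refine Measurable.prodMk (by fun_prop) (measurable_pi_iff.2 fun i => ?_)
    by_cases hi : i = m
    · subst hi; simpa using measurable_pi_apply none
    · simpa [Function.update_of_ne hi] using measurable_pi_apply (some i)
  exact h1.comp hu

lemma IsInnovation.iIndep_comap (h : IsInnovation P ε ε') :
    iIndep (fun s : ℤ ⊕ ℤ => MeasurableSpace.comap (Sum.elim ε ε' s) inferInstance) P :=
  h.indep.iIndep

lemma IsInnovation.comap_elim_le (h : IsInnovation P ε ε') (s : ℤ ⊕ ℤ) :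
    MeasurableSpace.comap (Sum.elim ε ε' s) inferInstance ≤ ‹MeasurableSpace Ω› := by
  rcases s with i | i
  · exact (h.meas i).comap_le
  · exact (h.meas' i).comap_le

/-- A function of the history without `ε (k - m)` has the same conditional expectation whether or
not this innovation is conditioned on. -/
lemma IsInnovation.condExp_future_pastRepl [IsProbabilityMeasure P] (h : IsInnovation P ε ε')
    {g : (ℕ → ℝ) → ℝ} (hg : Measurable g) (k : ℤ) (m : ℕ)
    (hi : Integrable (fun ω => g (pastRepl ε ε' k m ω)) P) :
    P[fun ω => g (pastRepl ε ε' k m ω) | future ε (k - m)] =ᵐ[P]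
      P[fun ω => g (pastRepl ε ε' k m ω) | future ε (k - m + 1)] := by
  rw [future_eq_sup]
  let c : ℤ ⊕ ℤ → MeasurableSpace Ω := fun s =>
    MeasurableSpace.comap (Sum.elim ε ε' s) inferInstance
  have hind := indep_iSup_of_disjoint (m := c) h.comap_elim_le h.iIndep_comap
    (S := {Sum.inl (k - m)}ᶜ) (T := {Sum.inl (k - m)}) disjoint_compl_left
  have hT : (⨆ i ∈ ({Sum.inl (k - m)} : Set (ℤ ⊕ ℤ)), c i) =
      MeasurableSpace.comap (ε (k - m)) inferInstance := by simp [c]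
  rw [hT] at hind
  have hc : ∀ s : ℤ ⊕ ℤ, s ≠ Sum.inl (k - m) →
      c s ≤ ⨆ i ∈ ({Sum.inl (k - m)}ᶜ : Set (ℤ ⊕ ℤ)), c i :=
    fun s hs => le_iSup₂_of_le s hs le_rfl
  refine condExp_sup_of_indep (iSup₂_le fun s _ => h.comap_elim_le s) ?_ (h.meas _).comap_le hind
    ?_ hi
  · refine iSup₂_le fun i hi => hc (Sum.inl i) ?_
    have : k - m + 1 ≤ i := hi
    simp; omega
  · apply Measurable.stronglyMeasurable
    rw [pastRepl_eq]
    refine hg.comp ((@measurable_pi_iff _ _ _ (_) _ _).2 fun i => ?_)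
    refine (comap_measurable (Sum.elim ε ε' (replIndex k m i))).mono (hc _ ?_) le_rfl
    unfold replIndex
    split_ifs with hi
    · simp
    · simp; omega

/-- A history is independent of the later innovations. -/
lemma IsInnovation.condExp_future_succ [IsProbabilityMeasure P] (h : IsInnovation P ε ε')
    {g : (ℕ → ℝ) → ℝ} (hg : Measurable g) (k : ℤ) :
    P[fun ω => g (past ε k ω) | future ε (k + 1)] =ᵐ[P] fun _ => ∫ ω, g (past ε k ω) ∂P := by
  have hind : Indep (⨆ i ∈ Set.Iic k, MeasurableSpace.comap (ε i) inferInstance)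
      (future ε (k + 1)) P := by
    refine indep_iSup_of_disjoint (fun i => (h.meas i).comap_le) ?_ ?_
    · exact (h.indep.precomp Sum.inl_injective).iIndep
    · rw [Set.disjoint_left]
      intro i (hi : i ≤ k) (hi' : k + 1 ≤ i)
      omega
  refine condExp_indep_eq (iSup₂_le fun i _ => (h.meas i).comap_le) (h.future_le _) ?_ hind
  apply Measurable.stronglyMeasurable
  refine hg.comp ((@measurable_pi_iff _ _ _ (_) _ _).2 fun i => ?_)
  exact (comap_measurable (ε (k - i))).mono
    (le_iSup₂_of_le (k - i : ℤ) (show k - (i : ℤ) ≤ k by omega) le_rfl) le_rfl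

/-- The projections of `g (past ε k)` on the innovations of lag `m`, in reversed time, are
controlled by the physical dependence measure. -/
lemma IsInnovation.eLpNorm_condExp_sub_le [IsProbabilityMeasure P] (h : IsInnovation P ε ε')
    {g : (ℕ → ℝ) → ℝ} (hg : Measurable g) (k : ℤ) (m : ℕ) {p : ℝ≥0∞} (hp : 1 ≤ p)
    (hX : MemLp (fun ω => g (past ε k ω)) p P) :
    eLpNorm (P[fun ω => g (past ε k ω) | future ε (k - m)]
      - P[fun ω => g (past ε k ω) | future ε (k - m + 1)]) p P ≤
      2 * eLpNorm (fun ω => g (past ε k ω) - g (pastRepl ε ε' k m ω)) p P := by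
  set X : Ω → ℝ := fun ω => g (past ε k ω) with hXdef
  set Y : Ω → ℝ := fun ω => g (pastRepl ε ε' k m ω) with hYdef
  have hXY : IdentDistrib Y X P P := (h.identDistrib_pastRepl k k m).comp hg
  have hY : MemLp Y p P := hXY.symm.memLp_snd hX
  have hXi := hX.integrable hp
  have hYi := hY.integrable hp
  have e : P[X | future ε (k - m)] - P[X | future ε (k - m + 1)] =ᵐ[P]
      P[X - Y | future ε (k - m)] - P[X - Y | future ε (k - m + 1)] := by
    filter_upwards [h.condExp_future_pastRepl hg k m hYi,
      condExp_sub hXi hYi (future ε (k - m)), condExp_sub hXi hYi (future ε (k - m + 1))]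
      with ω h1 h2 h3
    simp only [Pi.sub_apply] at h2 h3 ⊢
    rw [h2, h3, h1]; ring
  rw [eLpNorm_congr_ae e]
  refine (eLpNorm_sub_le integrable_condExp.1 integrable_condExp.1 hp).trans ?_
  rw [two_mul]
  exact add_le_add (eLpNorm_condExp_le_eLpNorm _ hp) (eLpNorm_condExp_le_eLpNorm _ hp)

end Innovations

end ConditionalExpectation

/-! ### Moments of dependent sums -/

section DependentSums

variable {Ω : Type*} [MeasurableSpace Ω] {P : Measure Ω} {ε ε' : ℤ → Ω → ℝ}

/-- Lévy's upward theorem in reversed time: conditioning on more and more innovations of the past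
recovers a function of the history. -/
lemma IsInnovation.tendsto_condExp_future [IsProbabilityMeasure P] (h : IsInnovation P ε ε')
    {g : (ℕ → ℝ) → ℝ} (hg : Measurable g) (k : ℤ)
    (hX : Integrable (fun ω => g (past ε k ω)) P) :
    ∀ᵐ ω ∂P, Tendsto (fun M : ℕ => (P[fun ω => g (past ε k ω) | future ε (k - M + 1)]) ω) atTop
      (𝓝 (g (past ε k ω))) := by
  let ℱ : Filtration ℕ ‹MeasurableSpace Ω› :=
    { seq := fun M => future ε (k - M + 1)
      mono' := fun _ _ hab => future_antitone ε (by omega)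
      le' := fun _ => h.future_le _ }
  refine hX.tendsto_ae_condExp (ℱ := ℱ) ?_
  apply Measurable.stronglyMeasurable
  refine hg.comp ((@measurable_pi_iff _ _ _ (_) _ _).2 fun i => ?_)
  refine (comap_measurable (ε (k - i))).mono ?_ le_rfl
  exact (comap_le_future ε (by push_cast; omega)).trans
    (le_iSup (fun M : ℕ => future ε (k - M + 1)) (i + 1))

/-- Moment inequality for sums of functions of the innovations with summable physical dependence
measure. -/
theorem IsInnovation.eLpNorm_sum_sub_integral_le [IsProbabilityMeasure P]
    (h : IsInnovation P ε ε') (k : ℕ) {g : ℕ → (ℕ → ℝ) → ℝ} {I : Finset ℕ} {N : ℝ} (hN : 1 ≤ N)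
    (hI : (I.card : ℝ) ≤ N) (hg : ∀ a ∈ I, Measurable (g a))
    (hX : ∀ a ∈ I, MemLp (fun ω => g a (past ε a ω)) ((2 * k + 2 : ℕ) : ℝ≥0∞) P)
    {δ : ℕ → ℝ} (hδ0 : ∀ m, 0 ≤ δ m) (hδs : Summable δ)
    (hδ : ∀ a ∈ I, ∀ m, eLpNorm (fun ω => g a (past ε a ω) - g a (pastRepl ε ε' a m ω))
      ((2 * k + 2 : ℕ) : ℝ≥0∞) P ≤ ENNReal.ofReal (δ m)) :
    eLpNorm (fun ω => ∑ a ∈ I, (g a (past ε a ω) - ∫ ω', g a (past ε a ω') ∂P))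
      ((2 * k + 2 : ℕ) : ℝ≥0∞) P ≤
      ENNReal.ofReal (momentConst k * √N * (2 * ∑' m, δ m)) := by
  set p : ℝ≥0∞ := ((2 * k + 2 : ℕ) : ℝ≥0∞) with hp
  have hp1 : 1 ≤ p := by rw [hp]; norm_cast; omega
  have hB := one_le_momentConst k
  set X : ℕ → Ω → ℝ := fun a ω => g a (past ε a ω) with hXdef
  let D : ℕ → ℕ → Ω → ℝ := fun m a =>
    P[X a | future ε (a - m)] - P[X a | future ε (a - m + 1)]
  have hD : ∀ m, eLpNorm (fun ω => ∑ a ∈ I, D m a ω) p P ≤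
      ENNReal.ofReal (momentConst k * √N * (2 * δ m)) := by
    intro m
    refine eLpNorm_sum_le_of_reversedMartingale k (𝓗 := fun a => future ε (a - m + 1))
      (fun a => h.future_le _) hN (mul_nonneg zero_le_two (hδ0 m)) I hI ?_ ?_ ?_ ?_
    · intro a _ x _ hax
      refine StronglyMeasurable.sub ?_ ?_
      · exact stronglyMeasurable_condExp.mono (future_antitone ε (by omega))
      · exact stronglyMeasurable_condExp.mono (future_antitone ε (by omega))
    · exact fun a ha => ((hX a ha).condExp hp1).sub ((hX a ha).condExp hp1)
    · intro a ha
      have h1 := condExp_sub (μ := P) (integrable_condExp (f := X a) (m := future ε (a - m)))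
        (integrable_condExp (f := X a) (m := future ε (a - m + 1)) (μ := P))
        (future ε (a - m + 1))
      have h2 := condExp_condExp_of_le (μ := P) (f := X a)
        (future_antitone ε (by omega : (a : ℤ) - m ≤ a - m + 1)) (h.future_le _)
      have h3 : P[P[X a | future ε (a - m + 1)] | future ε (a - m + 1)] =
          P[X a | future ε (a - m + 1)] :=
        condExp_of_stronglyMeasurable (h.future_le _) stronglyMeasurable_condExp
          integrable_condExp
      filter_upwards [h1, h2] with ω e1 e2
      rw [e1, Pi.sub_apply, e2, h3, sub_self, Pi.zero_apply]
    · intro a ha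
      refine (h.eLpNorm_condExp_sub_le (hg a ha) a m hp1 (hX a ha)).trans ?_
      rw [ENNReal.ofReal_mul zero_le_two, ENNReal.ofReal_ofNat]
      gcongr
      exact hδ a ha m
  -- summing over the lags telescopes, and the partial sums converge to the centred sum
  let Z : ℕ → Ω → ℝ := fun M => ∑ m ∈ Finset.range M, fun ω => ∑ a ∈ I, D m a ω
  have hDm : ∀ m, AEStronglyMeasurable (fun ω => ∑ a ∈ I, D m a ω) P := fun m =>
    Finset.aestronglyMeasurable_fun_sum I fun a _ => integrable_condExp.1.sub integrable_condExp.1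
  have hZ : ∀ M, eLpNorm (Z M) p P ≤ ENNReal.ofReal (momentConst k * √N * (2 * ∑' m, δ m)) := by
    intro M
    refine (eLpNorm_sum_le (fun m _ => hDm m) hp1).trans ?_
    refine (Finset.sum_le_sum fun m _ => hD m).trans ?_
    rw [← ENNReal.ofReal_sum_of_nonneg fun m _ => by have := hδ0 m; positivity]
    apply ENNReal.ofReal_le_ofReal
    rw [← Finset.mul_sum, ← Finset.mul_sum]
    gcongr
    exact hδs.sum_le_tsum _ fun m _ => hδ0 m
  have hlim : ∀ᵐ ω ∂P, Tendsto (fun M => Z M ω) atTop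
      (𝓝 (∑ a ∈ I, (g a (past ε a ω) - ∫ ω', g a (past ε a ω') ∂P))) := by
    have h1 : ∀ᵐ ω ∂P, ∀ a ∈ I, Tendsto
        (fun M : ℕ => (P[X a | future ε (a - M + 1)]) ω) atTop (𝓝 (g a (past ε a ω))) :=
      (ae_ball_iff I.countable_toSet).2 fun a ha =>
        h.tendsto_condExp_future (hg a ha) a ((hX a ha).integrable hp1)
    have h2 : ∀ᵐ ω ∂P, ∀ a ∈ I, (P[X a | future ε (a + 1)]) ω = ∫ ω', g a (past ε a ω') ∂P :=
      (ae_ball_iff I.countable_toSet).2 fun a ha => h.condExp_future_succ (hg a ha) a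
    filter_upwards [h1, h2] with ω e1 e2
    have hZω : ∀ M, Z M ω = ∑ a ∈ I, ((P[X a | future ε (a - M + 1)]) ω
        - ∫ ω', g a (past ε a ω') ∂P) := by
      intro M
      simp only [Z, Finset.sum_apply]
      rw [Finset.sum_comm]
      refine Finset.sum_congr rfl fun a ha => ?_
      have h3 := Finset.sum_range_sub
        (fun m : ℕ => (P[X a | future ε ((a : ℤ) - m + 1)]) ω) M
      rw [← e2 a ha]
      simp only [Nat.cast_zero, sub_zero] at h3
      rw [← h3]
      refine Finset.sum_congr rfl fun m _ => ?_
      simp only [D, Pi.sub_apply]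
      rw [show (a : ℤ) - ((m + 1 : ℕ) : ℤ) + 1 = a - m by push_cast; ring]
    simp only [hZω]
    exact tendsto_finsetSum I fun a ha => (e1 a ha).sub_const _
  refine (Lp.eLpNorm_lim_le_liminf_eLpNorm
    (fun M => Finset.aestronglyMeasurable_sum _ fun m _ => hDm m) _ hlim).trans ?_
  exact liminf_le_of_le (by isBoundedDefault) fun b hb => by
    obtain ⟨M, hM⟩ := hb.exists
    exact hM.trans (hZ M)

end DependentSums

section Errors

variable {Ω : Type*} {ε ε' : ℤ → Ω → ℝ} {r : ℕ} {brk : Fin (r + 2) → ℝ}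
  {G : Fin (r + 1) → ℝ → (ℕ → ℝ) → ℝ} {e : ℕ → ℕ → Ω → ℝ}

lemma IsPLS.exists_mem_Ioc (h : IsPLS ε brk G e) {t : ℝ} (ht0 : 0 < t) (ht1 : t ≤ 1) :
    ∃ j : Fin (r + 1), t ∈ Set.Ioc (brk j.castSucc) (brk j.succ) := by
  by_contra! hcon
  have key : ∀ j : Fin (r + 2), brk j < t := by
    intro j
    induction j using Fin.induction with
    | zero => rw [h.brk_zero]; exact ht0
    | succ j ih =>
      by_contra! hle
      exact hcon j ⟨ih, hle⟩
  have := key (Fin.last (r + 1))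
  rw [h.brk_last] at this
  linarith

variable [MeasurableSpace Ω] {P : Measure Ω}

/-- The errors as functions of the history, with a uniform moment bound and a uniform geometric
bound for the effect of replacing one innovation. -/
lemma IsPLS.exists_filter_bounds [IsProbabilityMeasure P] (h : IsPLS ε brk G e)
    (hε : IsInnovation P ε ε') {p : ℝ≥0∞} (hp : 1 ≤ p) (hmom : HasBoundedMoments P ε brk G p)
    (hdep : HasGeometricDependence P ε ε' brk G p) :
    ∃ A C χ : ℝ, 0 ≤ A ∧ 0 ≤ C ∧ 0 < χ ∧ χ < 1 ∧ ∀ n i : ℕ, 1 ≤ i → i ≤ n →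
      ∃ g : (ℕ → ℝ) → ℝ, Measurable g ∧ (∀ ω, e n i ω = g (past ε i ω)) ∧
        eLpNorm (fun ω => g (past ε i ω)) p P ≤ ENNReal.ofReal A ∧
        (∀ m, eLpNorm (fun ω => g (pastRepl ε ε' i m ω)) p P ≤ ENNReal.ofReal A) ∧
        ∀ m : ℕ, eLpNorm (fun ω => g (past ε i ω) - g (pastRepl ε ε' i m ω)) p P ≤
          ENNReal.ofReal (C * χ ^ m) := by
  obtain ⟨χ, hχ0, hχ1, C, hC⟩ := hdep
  set s : ℝ≥0∞ := ⨆ j : Fin (r + 1), ⨆ t ∈ Set.Ioc (brk j.castSucc) (brk j.succ),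
    eLpNorm (fun ω => G j t (past ε 0 ω)) p P with hs
  have hsA : s = ENNReal.ofReal s.toReal := (ENNReal.ofReal_toReal hmom.ne).symm
  set A := s.toReal with hA
  have hA0 : 0 ≤ A := ENNReal.toReal_nonneg
  refine ⟨A, max C (2 * A), χ, hA0, le_max_of_le_right (by positivity), hχ0, hχ1, ?_⟩
  intro n i hi hin
  have hn : (0 : ℝ) < n := by exact_mod_cast (show 0 < n by omega)
  obtain ⟨j, hj⟩ := h.exists_mem_Ioc (t := (i : ℝ) / n)
    (div_pos (by exact_mod_cast hi) hn) ((div_le_one hn).2 (by exact_mod_cast hin))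
  have hg := h.meas j _ (Set.Ioc_subset_Icc_self hj)
  set g := G j ((i : ℝ) / n) with hgdef
  have h0 : eLpNorm (fun ω => g (past ε 0 ω)) p P ≤ ENNReal.ofReal A := by
    rw [← hsA, hs]
    exact le_iSup_of_le j (le_iSup₂_of_le ((i : ℝ) / n) hj le_rfl)
  have h1 : eLpNorm (fun ω => g (past ε i ω)) p P ≤ ENNReal.ofReal A :=
    (((hε.identDistrib_past i 0).comp hg).eLpNorm_eq p).trans_le h0
  have h2 : ∀ m, eLpNorm (fun ω => g (pastRepl ε ε' i m ω)) p P ≤ ENNReal.ofReal A := fun m =>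
    (((hε.identDistrib_pastRepl i 0 m).comp hg).eLpNorm_eq p).trans_le h0
  refine ⟨g, hg, h.eq n i hi hin j hj, h1, h2, fun m => ?_⟩
  -- the decay of the dependence measure is assumed for positive lags only; lag zero is covered by
  -- the moment bound
  rcases Nat.eq_zero_or_pos m with rfl | hm
  · refine (eLpNorm_sub_le (hg.comp (hε.measurable_past _)).aestronglyMeasurable
      (hg.comp (hε.measurable_pastRepl _ _)).aestronglyMeasurable hp).trans ?_
    refine (add_le_add h1 (h2 0)).trans ?_
    rw [← ENNReal.ofReal_add hA0 hA0]
    apply ENNReal.ofReal_le_ofReal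
    rw [pow_zero, mul_one, ← two_mul]
    exact le_max_right _ _
  · have hident := (hε.identDistrib_past_pastRepl i m m).comp
      (u := fun x : (ℕ → ℝ) × (ℕ → ℝ) => g x.1 - g x.2)
      ((hg.comp measurable_fst).sub (hg.comp measurable_snd))
    refine (hident.eLpNorm_eq p).trans_le ?_
    have h3 : eLpNorm (fun ω => g (past ε m ω) - g (pastStar ε ε' m ω)) p P ≤
        physDep P ε ε' brk G p m :=
      le_iSup_of_le j (le_iSup₂_of_le ((i : ℝ) / n) hj le_rfl)
    rw [pastStar_eq_pastRepl] at h3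
    refine (h3.trans (hC m hm)).trans (ENNReal.ofReal_le_ofReal ?_)
    gcongr
    exact le_max_left _ _

/-- Hölder's inequality in the form used for squares of the errors and their differences. -/
lemma eLpNorm_mul_le_ofReal {f g : Ω → ℝ} (hf : AEStronglyMeasurable f P)
    (hg : AEStronglyMeasurable g P) (k : ℕ) {x y : ℝ} (hx : 0 ≤ x)
    (hfx : eLpNorm f ((4 * k + 4 : ℕ) : ℝ≥0∞) P ≤ ENNReal.ofReal x)
    (hgy : eLpNorm g ((4 * k + 4 : ℕ) : ℝ≥0∞) P ≤ ENNReal.ofReal y) :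
    eLpNorm (fun ω => f ω * g ω) ((2 * k + 2 : ℕ) : ℝ≥0∞) P ≤ ENNReal.ofReal (x * y) := by
  have hH : ENNReal.HolderTriple ((4 * k + 4 : ℕ) : ℝ≥0∞) ((4 * k + 4 : ℕ) : ℝ≥0∞)
      ((2 * k + 2 : ℕ) : ℝ≥0∞) := by
    constructor
    rw [show 4 * k + 4 = 2 * (2 * k + 2) by ring, Nat.cast_mul,
      ENNReal.mul_inv (Or.inl (by simp)) (Or.inl (by simp)), ← two_mul, ← mul_assoc,
      Nat.cast_ofNat, ENNReal.mul_inv_cancel (by simp) (by simp), one_mul]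
  have := eLpNorm_smul_le_mul_eLpNorm (r := ((2 * k + 2 : ℕ) : ℝ≥0∞)) hg hf
    (p := ((4 * k + 4 : ℕ) : ℝ≥0∞)) (q := ((4 * k + 4 : ℕ) : ℝ≥0∞))
  refine this.trans ?_
  rw [ENNReal.ofReal_mul hx]
  exact mul_le_mul' hfx hgy

/-- Moments of sums of centred squared errors. -/
theorem IsPLS.exists_eLpNorm_sum_sq_sub_le [IsProbabilityMeasure P] (h : IsPLS ε brk G e)
    (hε : IsInnovation P ε ε') (k : ℕ) {p : ℝ≥0∞} (hp : ((4 * k + 4 : ℕ) : ℝ≥0∞) ≤ p)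
    (hmom : HasBoundedMoments P ε brk G p) (hdep : HasGeometricDependence P ε ε' brk G p)
    {v : ℝ → ℝ} (hvar : HasVarianceFunction P e v) :
    ∃ C : ℝ, 0 ≤ C ∧ ∀ n : ℕ, ∀ I ⊆ Finset.Icc 1 n, ∀ N : ℝ, 1 ≤ N → (I.card : ℝ) ≤ N →
      eLpNorm (fun ω => ∑ i ∈ I, (e n i ω ^ 2 - v ((i : ℝ) / n))) ((2 * k + 2 : ℕ) : ℝ≥0∞) P ≤
        ENNReal.ofReal (C * √N) := by
  have hp1 : 1 ≤ p := le_trans (by norm_cast; omega) hp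
  obtain ⟨A, C, χ, hA, hC, hχ0, hχ1, hbd⟩ := h.exists_filter_bounds hε hp1 hmom hdep
  have hB := one_le_momentConst k
  set δ : ℕ → ℝ := fun m => C * χ ^ m * (A + A) with hδ
  have hδ0 : ∀ m, 0 ≤ δ m := fun m => by positivity
  have hδs : Summable δ :=
    ((summable_geometric_of_lt_one hχ0.le hχ1).mul_left C).mul_right (A + A)
  have hδS : 0 ≤ ∑' m, δ m := tsum_nonneg hδ0
  refine ⟨momentConst k * (2 * ∑' m, δ m), by positivity, ?_⟩
  intro n I hI N hN hIN
  choose! g hgm hge hgA hgA' hgδ using fun i (hi : i ∈ Finset.Icc 1 n) =>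
    hbd n i (Finset.mem_Icc.1 hi).1 (Finset.mem_Icc.1 hi).2
  have hm1 : ∀ i ∈ I, AEStronglyMeasurable (fun ω => g i (past ε i ω)) P := fun i hi =>
    ((hgm i (hI hi)).comp (hε.measurable_past _)).aestronglyMeasurable
  have hm2 : ∀ i ∈ I, ∀ m, AEStronglyMeasurable (fun ω => g i (pastRepl ε ε' i m ω)) P :=
    fun i hi m => ((hgm i (hI hi)).comp (hε.measurable_pastRepl _ _)).aestronglyMeasurable
  have hgA4 : ∀ i ∈ I, eLpNorm (fun ω => g i (past ε i ω)) ((4 * k + 4 : ℕ) : ℝ≥0∞) P ≤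
      ENNReal.ofReal A := fun i hi =>
    (eLpNorm_le_eLpNorm_of_exponent_le hp (hm1 i hi)).trans (hgA i (hI hi))
  have hsq : ∀ i ∈ I, MemLp (fun ω => g i (past ε i ω) ^ 2) ((2 * k + 2 : ℕ) : ℝ≥0∞) P := by
    intro i hi
    have := eLpNorm_mul_le_ofReal (hm1 i hi) (hm1 i hi) k hA (hgA4 i hi) (hgA4 i hi)
    simp only [← pow_two] at this
    exact ⟨(hm1 i hi).pow 2, this.trans_lt ENNReal.ofReal_lt_top⟩
  have main := hε.eLpNorm_sum_sub_integral_le k (g := fun i x => g i x ^ 2) (I := I) hN hIN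
    (fun i hi => (hgm i (hI hi)).pow_const 2) hsq hδ0 hδs ?_
  · have hEq : (fun ω => ∑ i ∈ I, (e n i ω ^ 2 - v ((i : ℝ) / n))) = fun ω =>
        ∑ i ∈ I, (g i (past ε i ω) ^ 2 - ∫ ω', g i (past ε i ω') ^ 2 ∂P) := by
      funext ω
      refine Finset.sum_congr rfl fun i hi => ?_
      have hi' := Finset.mem_Icc.1 (hI hi)
      have hef : e n i = fun ω => g i (past ε i ω) := funext (hge i (hI hi))
      rw [← hvar.var_eq n i hi'.1 hi'.2, hef, variance_of_integral_eq_zero]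
      · exact (hm1 i hi).aemeasurable
      · have := hvar.mean_zero n i hi'.1 hi'.2
        rwa [hef] at this
    rw [hEq]
    refine main.trans (ENNReal.ofReal_le_ofReal (le_of_eq (by ring)))
  · intro i hi m
    have h1 := eLpNorm_mul_le_ofReal ((hm1 i hi).sub (hm2 i hi m)) ((hm1 i hi).add (hm2 i hi m)) k
      (x := C * χ ^ m) (y := A + A) (by positivity)
      ((eLpNorm_le_eLpNorm_of_exponent_le hp ((hm1 i hi).sub (hm2 i hi m))).trans
        (hgδ i (hI hi) m)) ?_
    · refine le_trans (le_of_eq ?_) h1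
      congr 1; funext ω
      simp only [Pi.sub_apply, Pi.add_apply]; ring
    · refine (eLpNorm_add_le (hm1 i hi) (hm2 i hi m) (by norm_cast; omega)).trans ?_
      rw [ENNReal.ofReal_add hA hA]
      exact add_le_add (hgA4 i hi)
        ((eLpNorm_le_eLpNorm_of_exponent_le hp (hm2 i hi m)).trans (hgA' i (hI hi) m))

/-- Fourth moments of weighted sums of the errors. -/
theorem IsPLS.exists_eLpNorm_weighted_sum_le [IsProbabilityMeasure P] (h : IsPLS ε brk G e)
    (hε : IsInnovation P ε ε') {p : ℝ≥0∞} (hp : ((2 * 1 + 2 : ℕ) : ℝ≥0∞) ≤ p)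
    (hmom : HasBoundedMoments P ε brk G p) (hdep : HasGeometricDependence P ε ε' brk G p)
    (hmean : ∀ n i : ℕ, 1 ≤ i → i ≤ n → ∫ ω, e n i ω ∂P = 0) {W : ℝ} (hW : 0 ≤ W) :
    ∃ C : ℝ, 0 ≤ C ∧ ∀ n : ℕ, ∀ I ⊆ Finset.Icc 1 n, ∀ N : ℝ, 1 ≤ N → (I.card : ℝ) ≤ N →
      ∀ w : ℕ → ℝ, (∀ i, |w i| ≤ W) →
      eLpNorm (fun ω => ∑ i ∈ I, w i * e n i ω) ((2 * 1 + 2 : ℕ) : ℝ≥0∞) P ≤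
        ENNReal.ofReal (C * √N) := by
  have hp1 : 1 ≤ p := le_trans (by norm_cast) hp
  obtain ⟨A, C, χ, hA, hC, hχ0, hχ1, hbd⟩ := h.exists_filter_bounds hε hp1 hmom hdep
  have hB := one_le_momentConst 1
  set δ : ℕ → ℝ := fun m => W * (C * χ ^ m) with hδ
  have hδ0 : ∀ m, 0 ≤ δ m := fun m => by positivity
  have hδs : Summable δ := ((summable_geometric_of_lt_one hχ0.le hχ1).mul_left C).mul_left W
  have hδS : 0 ≤ ∑' m, δ m := tsum_nonneg hδ0
  refine ⟨momentConst 1 * (2 * ∑' m, δ m), by positivity, ?_⟩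
  intro n I hI N hN hIN w hw
  choose! g hgm hge hgA hgA' hgδ using fun i (hi : i ∈ Finset.Icc 1 n) =>
    hbd n i (Finset.mem_Icc.1 hi).1 (Finset.mem_Icc.1 hi).2
  have hm1 : ∀ i ∈ I, AEStronglyMeasurable (fun ω => g i (past ε i ω)) P := fun i hi =>
    ((hgm i (hI hi)).comp (hε.measurable_past _)).aestronglyMeasurable
  have hm2 : ∀ i ∈ I, ∀ m, AEStronglyMeasurable (fun ω => g i (pastRepl ε ε' i m ω)) P :=
    fun i hi m => ((hgm i (hI hi)).comp (hε.measurable_pastRepl _ _)).aestronglyMeasurable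
  have hLp : ∀ i ∈ I, MemLp (fun ω => w i * g i (past ε i ω)) ((2 * 1 + 2 : ℕ) : ℝ≥0∞) P :=
    fun i hi => MemLp.const_mul ⟨hm1 i hi, lt_of_le_of_lt
      ((eLpNorm_le_eLpNorm_of_exponent_le hp (hm1 i hi)).trans (hgA i (hI hi)))
      ENNReal.ofReal_lt_top⟩ _
  have main := hε.eLpNorm_sum_sub_integral_le 1 (g := fun i x => w i * g i x) (I := I) hN hIN
    (fun i hi => (hgm i (hI hi)).const_mul _) hLp hδ0 hδs ?_
  · have hEq : (fun ω => ∑ i ∈ I, w i * e n i ω) = fun ω =>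
        ∑ i ∈ I, (w i * g i (past ε i ω) - ∫ ω', w i * g i (past ε i ω') ∂P) := by
      funext ω
      refine Finset.sum_congr rfl fun i hi => ?_
      have hi' := Finset.mem_Icc.1 (hI hi)
      have hef : e n i = fun ω => g i (past ε i ω) := funext (hge i (hI hi))
      have := hmean n i hi'.1 hi'.2
      rw [hef] at this
      rw [hef, integral_const_mul, this, mul_zero, sub_zero]
    rw [hEq]
    refine main.trans (ENNReal.ofReal_le_ofReal (le_of_eq (by ring)))
  · intro i hi m
    have h1 : (fun ω => w i * g i (past ε i ω) - w i * g i (pastRepl ε ε' i m ω)) =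
        w i • fun ω => g i (past ε i ω) - g i (pastRepl ε ε' i m ω) := by
      funext ω; simp only [Pi.smul_apply, smul_eq_mul]; ring
    rw [h1, eLpNorm_const_smul, hδ, ENNReal.ofReal_mul hW]
    refine mul_le_mul' ?_ ((eLpNorm_le_eLpNorm_of_exponent_le hp
      ((hm1 i hi).sub (hm2 i hi m))).trans (hgδ i (hI hi) m))
    rw [← ofReal_norm]
    exact ENNReal.ofReal_le_ofReal (hw i)

end Errors

/-! ### Uniform smallness of block sums and kernel sums -/

/-- Markov's inequality for a moment of integer order. -/
lemma measure_le_abs_le_of_eLpNorm_le {Ω : Type*} [MeasurableSpace Ω] {P : Measure Ω} {S : Ω → ℝ}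
    (hS : AEStronglyMeasurable S P) {q : ℕ} (hq : q ≠ 0) {c x : ℝ} (hc : 0 ≤ c) (hx : 0 < x)
    (h : eLpNorm S (q : ℝ≥0∞) P ≤ ENNReal.ofReal c) :
    P {ω | x ≤ |S ω|} ≤ ENNReal.ofReal ((c / x) ^ q) := by
  have h1 := meas_ge_le_mul_pow_eLpNorm_enorm P (p := (q : ℝ≥0∞)) (by exact_mod_cast hq)
    (ENNReal.natCast_ne_top q) hS (ε := ENNReal.ofReal x) (by simpa using hx) (by simp)
  have h2 : {ω | x ≤ |S ω|} = {ω | ENNReal.ofReal x ≤ ‖S ω‖ₑ} := by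
    ext ω
    simp only [Set.mem_ofPred_eq]
    rw [← ofReal_norm, ENNReal.ofReal_le_ofReal_iff (norm_nonneg _), Real.norm_eq_abs]
  rw [h2]
  refine h1.trans ?_
  rw [ENNReal.toReal_natCast, ENNReal.rpow_natCast, ENNReal.rpow_natCast, div_eq_inv_mul,
    ← mul_pow, ENNReal.ofReal_pow (by positivity), ENNReal.ofReal_mul (by positivity),
    ENNReal.ofReal_inv_of_pos hx]
  gcongr

section Bandwidth

variable {b : ℕ → ℝ}

lemma tendsto_bandwidth_zero (hb6 : Tendsto (fun n : ℕ => (n : ℝ) * b n ^ 6) atTop (𝓝 0)) :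
    Tendsto b atTop (𝓝 0) := by
  rw [Metric.tendsto_atTop'] at hb6 ⊢
  intro ε hε
  obtain ⟨N, hN⟩ := hb6 (ε ^ 6) (by positivity)
  refine ⟨N, fun n hn => ?_⟩
  have h1 := hN n hn
  rw [Real.dist_eq, sub_zero] at h1 ⊢
  have hn1 : (1 : ℝ) ≤ n := by exact_mod_cast (show 1 ≤ n by omega)
  have h2 : |b n| ^ 6 < ε ^ 6 := by
    refine lt_of_le_of_lt ?_ h1
    rw [abs_mul, abs_pow, Nat.abs_cast]
    exact le_mul_of_one_le_left (by positivity) hn1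
  exact lt_of_pow_lt_pow_left₀ 6 hε.le h2

lemma eventually_bandwidth_pos (hb3 : Tendsto (fun n : ℕ => (n : ℝ) * b n ^ 3) atTop atTop) :
    ∀ᶠ n in atTop, 0 < b n := by
  filter_upwards [hb3.eventually_gt_atTop 0] with n hn
  by_contra! hle
  have : b n ^ 3 ≤ 0 := Odd.pow_nonpos (by decide) hle
  have : (n : ℝ) * b n ^ 3 ≤ 0 := mul_nonpos_of_nonneg_of_nonpos (by positivity) this
  linarith

lemma tendsto_mul_bandwidth_pow
    (hb6 : Tendsto (fun n : ℕ => (n : ℝ) * b n ^ 6) atTop (𝓝 0))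
    (hb3 : Tendsto (fun n : ℕ => (n : ℝ) * b n ^ 3) atTop atTop) {m : ℕ} (hm : m ≤ 3) :
    Tendsto (fun n : ℕ => (n : ℝ) * b n ^ m) atTop atTop := by
  refine tendsto_atTop_mono' atTop ?_ hb3
  filter_upwards [eventually_bandwidth_pos hb3,
    (tendsto_bandwidth_zero hb6).eventually_le_const one_pos] with n h0 h1
  gcongr ?_ * ?_
  exact pow_le_pow_of_le_one h0.le h1 hm

end Bandwidth

section KernelSums

lemma card_filter_abs_sub_le (n j : ℕ) {N : ℝ} (hN : 1 ≤ N) :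
    (((Finset.Icc 1 n).filter fun i : ℕ => |(i : ℝ) - j| ≤ N).card : ℝ) ≤ 3 * N := by
  have hsub : ((Finset.Icc 1 n).filter fun i : ℕ => |(i : ℝ) - j| ≤ N) ⊆
      Finset.Icc (j - ⌊N⌋₊) (j + ⌊N⌋₊) := by
    intro i hi
    have h := (Finset.mem_filter.1 hi).2
    rw [abs_le] at h
    rw [Finset.mem_Icc]
    constructor
    · rcases le_total j i with hji | hji
      · omega
      · have : j - i ≤ ⌊N⌋₊ := Nat.le_floor (by rw [Nat.cast_sub hji]; linarith)
        omega
    · rcases le_total i j with hji | hji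
      · omega
      · have : i - j ≤ ⌊N⌋₊ := Nat.le_floor (by rw [Nat.cast_sub hji]; linarith)
        omega
  have h1 := Finset.card_le_card hsub
  rw [Nat.card_Icc] at h1
  have h2 : ((Finset.Icc 1 n).filter fun i : ℕ => |(i : ℝ) - j| ≤ N).card ≤ 2 * ⌊N⌋₊ + 1 := by
    omega
  have h3 : (⌊N⌋₊ : ℝ) ≤ N := Nat.floor_le (by linarith)
  have h4 : (((Finset.Icc 1 n).filter fun i : ℕ => |(i : ℝ) - j| ≤ N).card : ℝ) ≤
      2 * ⌊N⌋₊ + 1 := by exact_mod_cast h2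
  linarith

lemma IsKernel.eq_zero {K : ℝ → ℝ} (hK : IsKernel K) {x : ℝ} (hx : 1 < |x|) : K x = 0 := by
  by_contra h
  have := hK.supp h
  rw [Set.mem_Icc, ← abs_le] at this
  linarith

lemma IsKernel.exists_bound {K : ℝ → ℝ} (hK : IsKernel K) : ∃ W : ℝ, 0 ≤ W ∧ ∀ x, |K x| ≤ W := by
  obtain ⟨W, hW⟩ := isCompact_Icc.exists_bound_of_continuousOn hK.smooth.continuousOn
  refine ⟨max W 0, le_max_right _ _, fun x => ?_⟩
  rcases le_or_gt |x| 1 with h | h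
  · exact (hW x (abs_le.1 h)).trans (le_max_left _ _)
  · rw [hK.eq_zero h, abs_zero]; exact le_max_right _ _

lemma one_lt_abs_div_sub_div {n : ℕ} {b : ℝ} (hn : 0 < n) (hb : 0 < b) {i j : ℕ}
    (h : ¬ |(i : ℝ) - j| ≤ n * b) : 1 < |((i : ℝ) / n - (j : ℝ) / n) / b| := by
  have hn' : (0 : ℝ) < n := by exact_mod_cast hn
  rw [← sub_div, div_div, abs_div, abs_of_pos (mul_pos hn' hb), one_lt_div (mul_pos hn' hb)]
  exact not_le.1 h

end KernelSums

section Errors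

variable {Ω : Type*} [MeasurableSpace Ω] {P : Measure Ω} {ε ε' : ℤ → Ω → ℝ}
  {r : ℕ} {brk : Fin (r + 2) → ℝ} {G : Fin (r + 1) → ℝ → (ℕ → ℝ) → ℝ} {e : ℕ → ℕ → Ω → ℝ}

lemma IsPLS.measurable_error (h : IsPLS ε brk G e) (hε : IsInnovation P ε ε') {n i : ℕ}
    (hi : 1 ≤ i) (hin : i ≤ n) : Measurable (e n i) := by
  have hn : (0 : ℝ) < n := by exact_mod_cast (show 0 < n by omega)
  obtain ⟨j, hj⟩ := h.exists_mem_Ioc (t := (i : ℝ) / n)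
    (div_pos (by exact_mod_cast hi) hn) ((div_le_one hn).2 (by exact_mod_cast hin))
  rw [show e n i = fun ω => G j ((i : ℝ) / n) (past ε i ω) from funext (h.eq n i hi hin j hj)]
  exact (h.meas j _ (Set.Ioc_subset_Icc_self hj)).comp (hε.measurable_past _)

/-- The kernel smoothed errors are uniformly small, by a fourth moment bound at each of the `n`
design points. -/
theorem IsPLS.tendsto_measure_kernel_sum [IsProbabilityMeasure P] (h : IsPLS ε brk G e)
    (hε : IsInnovation P ε ε') {p : ℝ≥0∞} (hp : ((2 * 1 + 2 : ℕ) : ℝ≥0∞) ≤ p)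
    (hmom : HasBoundedMoments P ε brk G p) (hdep : HasGeometricDependence P ε ε' brk G p)
    (hmean : ∀ n i : ℕ, 1 ≤ i → i ≤ n → ∫ ω, e n i ω ∂P = 0)
    {K : ℝ → ℝ} (hK : IsKernel K) {b : ℕ → ℝ}
    (hb6 : Tendsto (fun n : ℕ => (n : ℝ) * b n ^ 6) atTop (𝓝 0))
    (hb3 : Tendsto (fun n : ℕ => (n : ℝ) * b n ^ 3) atTop atTop) {δ : ℝ} (hδ : 0 < δ) :
    Tendsto (fun n : ℕ => P {ω | ∃ j ∈ Finset.Icc 1 n, δ * (n * b n) ≤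
      |∑ i ∈ Finset.Icc 1 n, K (((i : ℝ) / n - (j : ℝ) / n) / b n) * e n i ω|}) atTop (𝓝 0) := by
  obtain ⟨W, hW0, hW⟩ := hK.exists_bound
  obtain ⟨C, hC, hbd⟩ := h.exists_eLpNorm_weighted_sum_le hε hp hmom hdep hmean hW0
  have hlim : Tendsto (fun n : ℕ => ENNReal.ofReal
      (9 * C ^ 4 / δ ^ 4 * ((n : ℝ) * b n ^ 2)⁻¹)) atTop (𝓝 0) := by
    have h1 := (tendsto_mul_bandwidth_pow hb6 hb3 (m := 2) (by norm_num)).inv_tendsto_atTop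
    have h2 := ENNReal.tendsto_ofReal (h1.const_mul (9 * C ^ 4 / δ ^ 4))
    simpa using h2
  refine tendsto_of_tendsto_of_tendsto_of_le_of_le' tendsto_const_nhds hlim
    (Eventually.of_forall fun _ => zero_le) ?_
  have hnb := tendsto_mul_bandwidth_pow hb6 hb3 (m := 1) (by norm_num)
  filter_upwards [eventually_bandwidth_pos hb3, hnb.eventually_ge_atTop 1, eventually_gt_atTop 0]
    with n hb0 hN1 hn
  rw [pow_one] at hN1
  set N : ℝ := n * b n with hN
  have hN0 : 0 < N := by linarith
  have hn' : (0 : ℝ) < n := by exact_mod_cast hn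
  have hpt : ∀ j ∈ Finset.Icc 1 n, P {ω | δ * N ≤
      |∑ i ∈ Finset.Icc 1 n, K (((i : ℝ) / n - (j : ℝ) / n) / b n) * e n i ω|} ≤
      ENNReal.ofReal ((C * √(3 * N) / (δ * N)) ^ 4) := by
    intro j _
    have hsum : (fun ω => ∑ i ∈ Finset.Icc 1 n, K (((i : ℝ) / n - (j : ℝ) / n) / b n) * e n i ω) =
        fun ω => ∑ i ∈ (Finset.Icc 1 n).filter (fun i : ℕ => |(i : ℝ) - j| ≤ N),
          K (((i : ℝ) / n - (j : ℝ) / n) / b n) * e n i ω := by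
      funext ω
      symm
      refine Finset.sum_filter_of_ne fun i _ hne => ?_
      by_contra hcon
      exact hne (by rw [hK.eq_zero (one_lt_abs_div_sub_div hn hb0 hcon), zero_mul])
    refine measure_le_abs_le_of_eLpNorm_le (q := 2 * 1 + 2) ?_ (by norm_num) (by positivity)
      (by positivity) ?_
    · refine Finset.aestronglyMeasurable_fun_sum _ fun i hi => ?_
      have hi' := Finset.mem_Icc.1 hi
      exact ((h.measurable_error hε hi'.1 hi'.2).const_mul _).aestronglyMeasurable
    · rw [hsum]
      exact hbd n _ (Finset.filter_subset _ _) (3 * N) (by linarith)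
        (card_filter_abs_sub_le n j hN1) (fun i => K (((i : ℝ) / n - (j : ℝ) / n) / b n))
        (fun i => hW _)
  have hset : {ω | ∃ j ∈ Finset.Icc 1 n, δ * N ≤
      |∑ i ∈ Finset.Icc 1 n, K (((i : ℝ) / n - (j : ℝ) / n) / b n) * e n i ω|} =
      ⋃ j ∈ Finset.Icc 1 n, {ω | δ * N ≤
        |∑ i ∈ Finset.Icc 1 n, K (((i : ℝ) / n - (j : ℝ) / n) / b n) * e n i ω|} := by
    ext ω; simp
  rw [hset]
  refine (measure_biUnion_finset_le _ _).trans ((Finset.sum_le_sum hpt).trans ?_)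
  rw [Finset.sum_const, Nat.card_Icc, Nat.add_sub_cancel, nsmul_eq_mul, ← ENNReal.ofReal_natCast,
    ← ENNReal.ofReal_mul hn'.le]
  apply ENNReal.ofReal_le_ofReal
  have h3 : √(3 * N) ^ 4 = 9 * N ^ 2 := by
    rw [show 4 = 2 * 2 by norm_num, pow_mul, Real.sq_sqrt (by positivity)]; ring
  rw [div_pow, mul_pow, h3, hN]
  apply le_of_eq
  field_simp

/-- The sums of squared errors over intervals which start at multiples of `L / R` and have length
`L ± L / R` are uniformly close to their means, where `L = ⌊n ^ α⌋`. There are about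
`R * n ^ (1 - α)` such intervals, and each deviates with probability of order
`n ^ (- α * (k + 1))`. -/
theorem IsPLS.tendsto_measure_block_sum [IsProbabilityMeasure P] (h : IsPLS ε brk G e)
    (hε : IsInnovation P ε ε') (k : ℕ) {p : ℝ≥0∞} (hp : ((4 * k + 4 : ℕ) : ℝ≥0∞) ≤ p)
    (hmom : HasBoundedMoments P ε brk G p) (hdep : HasGeometricDependence P ε ε' brk G p)
    {v : ℝ → ℝ} (hvar : HasVarianceFunction P e v) {α : ℝ} (hα0 : 0 < α) (hα1 : α < 1)
    (hα : 1 < α * (k + 2)) {R : ℕ} (hR : 1 ≤ R) {δ : ℝ} (hδ : 0 < δ) :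
    Tendsto (fun n : ℕ => P {ω | ∃ g ∈ Finset.range (n / (⌊(n : ℝ) ^ α⌋₊ / R) + 1),
      ∃ ℓ ∈ ({⌊(n : ℝ) ^ α⌋₊ - ⌊(n : ℝ) ^ α⌋₊ / R, ⌊(n : ℝ) ^ α⌋₊ + ⌊(n : ℝ) ^ α⌋₊ / R} : Finset ℕ),
      δ * ⌊(n : ℝ) ^ α⌋₊ ≤ |∑ i ∈ Finset.Ico (g * (⌊(n : ℝ) ^ α⌋₊ / R))
        (g * (⌊(n : ℝ) ^ α⌋₊ / R) + ℓ) ∩ Finset.Icc 1 n, (e n i ω ^ 2 - v ((i : ℝ) / n))|})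
      atTop (𝓝 0) := by
  obtain ⟨C, hC, hbd⟩ := h.exists_eLpNorm_sum_sq_sub_le hε k hp hmom hdep hvar
  set A : ℝ := 2 * (4 * R + 1) * (2 * C ^ 2 / δ ^ 2) ^ (k + 1) * 2 ^ (k + 1) with hA
  have hR' : (1 : ℝ) ≤ R := by exact_mod_cast hR
  have hA0 : 0 ≤ A := by positivity
  have hlim : Tendsto (fun n : ℕ => ENNReal.ofReal (A * (n : ℝ) ^ (-(α * (k + 2) - 1)))) atTop
      (𝓝 0) := by
    have h1 := (tendsto_rpow_neg_atTop (y := α * (k + 2) - 1) (by linarith)).comp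
      (tendsto_natCast_atTop_atTop (R := ℝ))
    have h2 := ENNReal.tendsto_ofReal (h1.const_mul A)
    simpa using h2
  refine tendsto_of_tendsto_of_tendsto_of_le_of_le' tendsto_const_nhds hlim
    (Eventually.of_forall fun _ => zero_le) ?_
  have hpow : Tendsto (fun n : ℕ => (n : ℝ) ^ α) atTop atTop :=
    (tendsto_rpow_atTop hα0).comp tendsto_natCast_atTop_atTop
  filter_upwards [hpow.eventually_ge_atTop (2 * R), eventually_gt_atTop 0] with n hnR hn
  set L := ⌊(n : ℝ) ^ α⌋₊ with hL
  set s := L / R with hs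
  have hn' : (1 : ℝ) ≤ n := by exact_mod_cast hn
  have hLR : 2 * R ≤ L := Nat.le_floor (by exact_mod_cast hnR)
  have hL1 : (1 : ℝ) ≤ L := by exact_mod_cast (show 1 ≤ L by omega)
  have hLn : (n : ℝ) ^ α ≤ 2 * L := by
    have := Nat.lt_floor_add_one ((n : ℝ) ^ α)
    rw [← hL] at this; linarith
  have hsL : s ≤ L := Nat.div_le_self _ _
  have hs2 : 2 ≤ s := (Nat.le_div_iff_mul_le (by omega)).2 hLR
  have hs1 : 1 ≤ s := by omega
  have hsR : L ≤ 2 * R * s := by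
    have h1 : L < R * s + R := by
      have := Nat.div_add_mod L R
      have h2 := Nat.mod_lt L (show 0 < R by omega)
      rw [hs]; omega
    nlinarith
  have hnpow : (n : ℝ) ^ α ≤ n := by
    calc (n : ℝ) ^ α ≤ (n : ℝ) ^ (1 : ℝ) := Real.rpow_le_rpow_of_exponent_le hn' hα1.le
      _ = n := Real.rpow_one _
  have hnpos : 0 < (n : ℝ) ^ α := by positivity
  have hcount : ((n / s + 1 : ℕ) : ℝ) ≤ (4 * R + 1) * (n / (n : ℝ) ^ α) := by
    have h1 : ((n / s : ℕ) : ℝ) ≤ (n : ℝ) / s := Nat.cast_div_le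
    have hs' : (1 : ℝ) ≤ s := by exact_mod_cast hs1
    have h2 : (n : ℝ) / s ≤ 4 * R * (n / (n : ℝ) ^ α) := by
      have h3 : (n : ℝ) ^ α ≤ 4 * R * s := by
        have : (L : ℝ) ≤ 2 * R * s := by exact_mod_cast hsR
        linarith
      rw [← mul_div_assoc, div_le_div_iff₀ (by linarith) hnpos]
      nlinarith
    have h4 : 1 ≤ n / (n : ℝ) ^ α := (one_le_div hnpos).2 hnpow
    push_cast
    linarith
  have hpt : ∀ g ∈ Finset.range (n / s + 1), ∀ ℓ ∈ ({L - s, L + s} : Finset ℕ),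
      P {ω | δ * L ≤ |∑ i ∈ Finset.Ico (g * s) (g * s + ℓ) ∩ Finset.Icc 1 n,
        (e n i ω ^ 2 - v ((i : ℝ) / n))|} ≤
      ENNReal.ofReal ((C * √(2 * L) / (δ * L)) ^ (2 * k + 2)) := by
    intro g _ ℓ hℓ
    have hℓ2 : ℓ ≤ 2 * L := by
      rw [Finset.mem_insert, Finset.mem_singleton] at hℓ
      omega
    refine measure_le_abs_le_of_eLpNorm_le ?_ (by omega) (by positivity) (by positivity) ?_
    · refine Finset.aestronglyMeasurable_fun_sum _ fun i hi => ?_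
      have hi' := Finset.mem_Icc.1 (Finset.mem_inter.1 hi).2
      exact (((h.measurable_error hε hi'.1 hi'.2).pow_const 2).sub_const _).aestronglyMeasurable
    · refine hbd n _ Finset.inter_subset_right (2 * L) (by linarith) ?_
      have h1 := Finset.card_le_card
        (Finset.inter_subset_left (s₁ := Finset.Ico (g * s) (g * s + ℓ)) (s₂ := Finset.Icc 1 n))
      rw [Nat.card_Ico, Nat.add_sub_cancel_left] at h1
      exact_mod_cast h1.trans hℓ2
  have hset : {ω | ∃ g ∈ Finset.range (n / s + 1), ∃ ℓ ∈ ({L - s, L + s} : Finset ℕ),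
      δ * L ≤ |∑ i ∈ Finset.Ico (g * s) (g * s + ℓ) ∩ Finset.Icc 1 n,
        (e n i ω ^ 2 - v ((i : ℝ) / n))|} =
      ⋃ g ∈ Finset.range (n / s + 1), ⋃ ℓ ∈ ({L - s, L + s} : Finset ℕ),
        {ω | δ * L ≤ |∑ i ∈ Finset.Ico (g * s) (g * s + ℓ) ∩ Finset.Icc 1 n,
          (e n i ω ^ 2 - v ((i : ℝ) / n))|} := by
    ext ω; simp only [Set.mem_ofPred_eq, Set.mem_iUnion, exists_prop]
  rw [hset]
  refine (measure_biUnion_finset_le _ _).trans ?_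
  refine (Finset.sum_le_sum fun g hg => (measure_biUnion_finset_le _ _).trans
    (Finset.sum_le_sum (hpt g hg))).trans ?_
  rw [Finset.sum_const, Finset.sum_const, Finset.card_range, nsmul_eq_mul, nsmul_eq_mul]
  have hcard : ((({L - s, L + s} : Finset ℕ).card : ℕ) : ℝ≥0∞) ≤ ENNReal.ofReal 2 := by
    rw [ENNReal.ofReal_ofNat]; exact_mod_cast Finset.card_le_two
  refine (mul_le_mul' le_rfl (mul_le_mul' hcard le_rfl)).trans ?_
  rw [← ENNReal.ofReal_natCast, ← ENNReal.ofReal_mul zero_le_two,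
    ← ENNReal.ofReal_mul (by positivity)]
  apply ENNReal.ofReal_le_ofReal
  have hterm : (C * √(2 * L) / (δ * L)) ^ (2 * k + 2) ≤
      (2 * C ^ 2 / δ ^ 2) ^ (k + 1) * (2 ^ (k + 1) * ((n : ℝ) ^ α)⁻¹ ^ (k + 1)) := by
    have h1 : (C * √(2 * L) / (δ * L)) ^ 2 = (2 * C ^ 2 / δ ^ 2) * (L : ℝ)⁻¹ := by
      rw [div_pow, mul_pow, Real.sq_sqrt (by positivity)]
      field_simp
    rw [show 2 * k + 2 = 2 * (k + 1) by ring, pow_mul, h1, mul_pow, ← mul_pow 2]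
    gcongr
    rw [← div_eq_mul_inv, inv_eq_one_div, div_le_div_iff₀ (by linarith) hnpos]
    linarith
  have hexp : (n : ℝ) / (n : ℝ) ^ α * ((n : ℝ) ^ α)⁻¹ ^ (k + 1) =
      (n : ℝ) ^ (-(α * (k + 2) - 1)) := by
    have hn0 : (0 : ℝ) < n := by linarith
    rw [div_eq_mul_inv, mul_assoc, ← pow_succ', ← Real.rpow_neg hn0.le, ← Real.rpow_natCast,
      ← Real.rpow_mul hn0.le]
    nth_rewrite 1 [← Real.rpow_one (n : ℝ)]
    rw [← Real.rpow_add hn0]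
    congr 1; push_cast; ring
  calc ((n / s + 1 : ℕ) : ℝ) * (2 * (C * √(2 * L) / (δ * L)) ^ (2 * k + 2))
      ≤ ((4 * R + 1) * (n / (n : ℝ) ^ α)) * (2 * ((2 * C ^ 2 / δ ^ 2) ^ (k + 1) *
          (2 ^ (k + 1) * ((n : ℝ) ^ α)⁻¹ ^ (k + 1)))) := by gcongr
    _ = A * ((n : ℝ) / (n : ℝ) ^ α * ((n : ℝ) ^ α)⁻¹ ^ (k + 1)) := by rw [hA]; ring
    _ = _ := by rw [hexp]

end Errors

/-! ### Riemann sums of the kernel -/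

section RiemannSum

lemma IsKernel.continuousAt {K : ℝ → ℝ} (hK : IsKernel K) {x : ℝ} (h1 : x ≠ 1) (h2 : x ≠ -1) :
    ContinuousAt K x := by
  rcases lt_or_ge 1 |x| with h | h
  · have hev : K =ᶠ[𝓝 x] fun _ => 0 := by
      filter_upwards [continuous_abs.continuousAt.eventually_const_lt h] with y hy
      exact hK.eq_zero hy
    exact continuousAt_const.congr hev.symm
  · have hx := abs_le.1 h
    exact hK.smooth.continuousOn.continuousAt
      (Icc_mem_nhds (lt_of_le_of_ne hx.1 h2.symm) (lt_of_le_of_ne hx.2 h1))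

lemma tendsto_floor_mul_div (x : ℝ) :
    Tendsto (fun N : ℝ => (⌊x * N⌋ : ℝ) / N) atTop (𝓝 x) := by
  have h1 : Tendsto (fun N : ℝ => x - N⁻¹) atTop (𝓝 x) := by
    simpa using tendsto_const_nhds.sub (tendsto_inv_atTop_zero (𝕜 := ℝ))
  refine tendsto_of_tendsto_of_tendsto_of_le_of_le' h1 tendsto_const_nhds ?_ ?_
  · filter_upwards [eventually_gt_atTop 0] with N hN
    rw [le_div_iff₀ hN, sub_mul, inv_mul_cancel₀ hN.ne']
    exact (Int.sub_one_lt_floor _).le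
  · filter_upwards [eventually_gt_atTop 0] with N hN
    rw [div_le_iff₀ hN]
    exact Int.floor_le _

lemma IsKernel.eq_zero_of_lt_abs_int {K : ℝ → ℝ} (hK : IsKernel K) {N : ℝ} (hN : 0 < N) {k : ℤ}
    (h : N < |(k : ℝ)|) : K (k / N) = 0 :=
  hK.eq_zero (by rwa [abs_div, abs_of_pos hN, one_lt_div hN])

/-- A Riemann sum of the kernel as the integral of a step function. -/
lemma IsKernel.integral_floor {K : ℝ → ℝ} (hK : IsKernel K) {N : ℝ} (hN : 0 < N) :
    ∫ x, K (⌊x * N⌋ / N) = (∑ k ∈ Finset.Icc (-(⌈N⌉₊ : ℤ)) ⌈N⌉₊, K (k / N)) / N := by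
  have hpt : ∀ x : ℝ, K (⌊x * N⌋ / N) = ∑ k ∈ Finset.Icc (-(⌈N⌉₊ : ℤ)) ⌈N⌉₊,
      (Set.Ico ((k : ℝ) / N) ((k + 1) / N)).indicator (fun _ => K (k / N)) x := by
    intro x
    have hmem : ∀ k : ℤ, x ∈ Set.Ico ((k : ℝ) / N) ((k + 1) / N) ↔ ⌊x * N⌋ = k := by
      intro k
      rw [Set.mem_Ico, div_le_iff₀ hN, lt_div_iff₀ hN, Int.floor_eq_iff]
    by_cases hk : ⌊x * N⌋ ∈ Finset.Icc (-(⌈N⌉₊ : ℤ)) ⌈N⌉₊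
    · rw [Finset.sum_eq_single_of_mem _ hk, Set.indicator_of_mem ((hmem _).2 rfl)]
      intro k _ hne
      exact Set.indicator_of_notMem (fun h => hne ((hmem k).1 h).symm) _
    · rw [Finset.sum_eq_zero]
      · refine hK.eq_zero_of_lt_abs_int hN ?_
        by_contra! hle
        apply hk
        have h1 : |⌊x * N⌋| ≤ (⌈N⌉₊ : ℤ) := by
          have : ((|⌊x * N⌋| : ℤ) : ℝ) ≤ ((⌈N⌉₊ : ℤ) : ℝ) := by
            push_cast; exact hle.trans (Nat.le_ceil N)
          exact_mod_cast this
        exact Finset.mem_Icc.2 (abs_le.1 h1)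
      · intro k hk'
        refine Set.indicator_of_notMem (fun h => hk ?_) _
        rwa [(hmem k).1 h]
  simp_rw [hpt]
  rw [integral_finsetSum]
  · rw [Finset.sum_div]
    refine Finset.sum_congr rfl fun k _ => ?_
    rw [integral_indicator measurableSet_Ico, setIntegral_const, Real.volume_real_Ico_of_le
      (by gcongr; linarith), smul_eq_mul]
    field_simp
    ring
  · intro k _
    exact (integrable_indicator_iff measurableSet_Ico).2 (integrableOn_const (by simp))

/-- Riemann sums of the kernel converge to its integral. The kernel may jump at `1` and `-1`. -/
theorem IsKernel.tendsto_riemann_sum {K : ℝ → ℝ} (hK : IsKernel K) :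
    Tendsto (fun N : ℝ => (∑ k ∈ Finset.Icc (-(⌈N⌉₊ : ℤ)) ⌈N⌉₊, K (k / N)) / N) atTop (𝓝 1) := by
  obtain ⟨W, hW0, hW⟩ := hK.exists_bound
  have hKm : Measurable K := by
    have h1 : K = (Set.Icc (-1 : ℝ) 1).indicator K := by
      funext x
      by_cases hx : x ∈ Set.Icc (-1 : ℝ) 1
      · rw [Set.indicator_of_mem hx]
      · rw [Set.indicator_of_notMem hx]
        exact hK.eq_zero (not_le.1 fun h => hx (abs_le.1 h))
    rw [h1, ← Set.piecewise_eq_indicator]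
    exact hK.smooth.continuousOn.measurable_piecewise continuousOn_const measurableSet_Icc
  have hlim : Tendsto (fun N : ℝ => ∫ x, K (⌊x * N⌋ / N)) atTop (𝓝 (∫ x, K x)) := by
    refine tendsto_integral_filter_of_dominated_convergence
      ((Set.Icc (-2 : ℝ) 2).indicator fun _ => W) ?_ ?_ ?_ ?_
    · refine Eventually.of_forall fun N => Measurable.aestronglyMeasurable ?_
      exact hKm.comp (by fun_prop)
    · filter_upwards [eventually_ge_atTop 1] with N hN
      refine ae_of_all _ fun x => ?_
      have hN0 : 0 < N := by linarith
      by_cases hx : x ∈ Set.Icc (-2 : ℝ) 2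
      · rw [Set.indicator_of_mem hx]; exact hW _
      · rw [Set.indicator_of_notMem hx, hK.eq_zero_of_lt_abs_int hN0, norm_zero]
        have h1 := Int.floor_le (x * N)
        have h2 := Int.sub_one_lt_floor (x * N)
        rw [Set.mem_Icc, not_and_or, not_le, not_le] at hx
        rw [lt_abs]
        rcases hx with hx | hx
        · right; nlinarith
        · left; nlinarith
    · exact (integrable_indicator_iff measurableSet_Icc).2 (integrableOn_const (by simp))
    · have h1 : ∀ᵐ x : ℝ, x ≠ 1 := Measure.ae_ne volume 1
      have h2 : ∀ᵐ x : ℝ, x ≠ -1 := Measure.ae_ne volume (-1)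
      filter_upwards [h1, h2] with x hx1 hx2
      exact (hK.continuousAt hx1 hx2).tendsto.comp (tendsto_floor_mul_div x)
  rw [hK.integral_eq] at hlim
  refine hlim.congr' ?_
  filter_upwards [eventually_gt_atTop 0] with N hN
  exact hK.integral_floor hN

end RiemannSum

/-! ### The local linear estimator at interior design points -/

section LocalLinear

/-- A sum over all design points of a function supported within distance `M` of an interior point
`j` does not depend on `j`. -/
lemma sum_Icc_shift {F : ℤ → ℝ} {M n j : ℕ} (hj : M < j) (hjn : j + M ≤ n)
    (hF : ∀ k : ℤ, (M : ℤ) < |k| → F k = 0) :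
    ∑ i ∈ Finset.Icc 1 n, F ((i : ℤ) - j) = ∑ k ∈ Finset.Icc (-(M : ℤ)) M, F k := by
  rw [← Finset.sum_subset (s₁ := Finset.Icc (j - M) (j + M))]
  · refine Finset.sum_bij (fun i _ => (i : ℤ) - j) ?_ ?_ ?_ (fun _ _ => rfl)
    · intro i hi
      simp only [Finset.mem_Icc] at hi ⊢
      omega
    · intro i _ i' _ h
      simpa using h
    · intro k hk
      rw [Finset.mem_Icc] at hk
      exact ⟨(k + j).toNat, by rw [Finset.mem_Icc]; omega, by omega⟩
  · intro i hi
    simp only [Finset.mem_Icc] at hi ⊢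
    omega
  · intro i _ hi
    apply hF
    rw [Finset.mem_Icc] at hi
    rw [lt_abs]
    omega

lemma sum_Icc_neg_self_of_odd {F : ℤ → ℝ} (hF : ∀ k, F (-k) = -F k) (M : ℕ) :
    ∑ k ∈ Finset.Icc (-(M : ℤ)) M, F k = 0 := by
  have h : ∑ k ∈ Finset.Icc (-(M : ℤ)) M, F k = ∑ k ∈ Finset.Icc (-(M : ℤ)) M, F (-k) :=
    Finset.sum_nbij' (fun k => -k) (fun k => -k)
      (fun k hk => by simp only [Finset.mem_Icc] at hk ⊢; omega)
      (fun k hk => by simp only [Finset.mem_Icc] at hk ⊢; omega)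
      (fun k _ => neg_neg k) (fun k _ => neg_neg k) (fun k _ => by rw [neg_neg])
  simp only [hF, Finset.sum_neg_distrib] at h
  linarith

/-- At an interior design point the symmetry of the kernel decouples the intercept from the slope,
so the local linear estimate is a kernel average of the data. Only the normal equation of the
intercept enters, so the kernel may change sign. -/
lemma IsLocalLinearEstimate.mul_sum_eq {K : ℝ → ℝ} {b : ℝ} {n : ℕ} {y : ℕ → ℝ} {t m : ℝ}
    (h : IsLocalLinearEstimate K b n y t m)
    (hS0 : 0 < ∑ i ∈ Finset.Icc 1 n, K (((i : ℝ) / n - t) / b))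
    (hS1 : ∑ i ∈ Finset.Icc 1 n, ((i : ℝ) / n - t) * K (((i : ℝ) / n - t) / b) = 0) :
    m * ∑ i ∈ Finset.Icc 1 n, K (((i : ℝ) / n - t) / b) =
      ∑ i ∈ Finset.Icc 1 n, y i * K (((i : ℝ) / n - t) / b) := by
  obtain ⟨d, hd⟩ := h
  set S0 := ∑ i ∈ Finset.Icc 1 n, K (((i : ℝ) / n - t) / b) with hS0def
  set A := ∑ i ∈ Finset.Icc 1 n,
    (y i - m - d * ((i : ℝ) / n - t)) * K (((i : ℝ) / n - t) / b) with hA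
  have hexp : ∀ x : ℝ, localLinearLoss K b n y t (m + x) d =
      localLinearLoss K b n y t m d - 2 * x * A + x ^ 2 * S0 := by
    intro x
    simp only [localLinearLoss, hA, hS0def, Finset.mul_sum]
    rw [← Finset.sum_sub_distrib, ← Finset.sum_add_distrib]
    exact Finset.sum_congr rfl fun i _ => by ring
  -- the loss is quadratic in the intercept; this is the point where it would be smallest
  have h1 := hd (m + A / S0) d
  rw [hexp] at h1
  have h2 : -2 * (A / S0) * A + (A / S0) ^ 2 * S0 = -(A ^ 2 / S0) := by field_simp; ring
  have h3 : A ^ 2 / S0 ≤ 0 := by linarith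
  have h4 : A = 0 := by
    by_contra hne
    have : 0 < A ^ 2 / S0 := by positivity
    linarith
  have h5 : A = ∑ i ∈ Finset.Icc 1 n, y i * K (((i : ℝ) / n - t) / b) - m * S0
      - d * ∑ i ∈ Finset.Icc 1 n, ((i : ℝ) / n - t) * K (((i : ℝ) / n - t) / b) := by
    simp only [hA, hS0def, Finset.mul_sum]
    rw [← Finset.sum_sub_distrib, ← Finset.sum_sub_distrib]
    exact Finset.sum_congr rfl fun i _ => by ring
  rw [h4, hS1] at h5
  linarith

/-- The error of the local linear estimate at an interior design point is bounded by the kernel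
smoothed errors and the oscillation of the mean function over one bandwidth. -/
lemma abs_localLinear_sub_le {K : ℝ → ℝ} (hK : IsKernel K) {W : ℝ} (hW : ∀ x, |K x| ≤ W)
    {b : ℝ} {n : ℕ} (hn : 0 < n) (hb : 0 < b) (hN : 1 ≤ n * b)
    (hS : 1 / 2 ≤ (∑ k ∈ Finset.Icc (-(⌈n * b⌉₊ : ℤ)) ⌈n * b⌉₊, K (k / (n * b))) / (n * b))
    {j : ℕ} (hj : ⌈n * b⌉₊ < j) (hjn : j + ⌈n * b⌉₊ ≤ n) {y u : ℕ → ℝ} {μ : ℝ → ℝ}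
    (hy : ∀ i ∈ Finset.Icc 1 n, y i = μ ((i : ℝ) / n) + u i) {η δ : ℝ}
    (hη : ∀ i ∈ Finset.Icc 1 n, |(i : ℝ) - j| ≤ n * b → |μ ((i : ℝ) / n) - μ ((j : ℝ) / n)| ≤ η)
    (hδ : |∑ i ∈ Finset.Icc 1 n, K (((i : ℝ) / n - (j : ℝ) / n) / b) * u i| ≤ δ * (n * b))
    {m : ℝ} (hm : IsLocalLinearEstimate K b n y ((j : ℝ) / n) m) :
    |m - μ ((j : ℝ) / n)| ≤ 2 * δ + 6 * W * η := by
  set N : ℝ := n * b with hNdef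
  have hN0 : 0 < N := by linarith
  have hn' : (0 : ℝ) < n := by exact_mod_cast hn
  have hW0 : 0 ≤ W := (abs_nonneg _).trans (hW 0)
  have hη0 : 0 ≤ η := by
    have := hη j (by rw [Finset.mem_Icc]; omega) (by simpa using hN0.le)
    exact (abs_nonneg _).trans this
  have harg : ∀ i : ℕ, ((i : ℝ) / n - (j : ℝ) / n) / b = (((i : ℤ) - j : ℤ) : ℝ) / N := by
    intro i; push_cast; rw [← sub_div, div_div]
  have hzero : ∀ k : ℤ, (⌈N⌉₊ : ℤ) < |k| → K (k / N) = 0 := by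
    intro k hk
    refine hK.eq_zero_of_lt_abs_int hN0 ((Nat.le_ceil N).trans_lt ?_)
    exact_mod_cast hk
  have hS0eq : ∑ i ∈ Finset.Icc 1 n, K (((i : ℝ) / n - (j : ℝ) / n) / b) =
      ∑ k ∈ Finset.Icc (-(⌈N⌉₊ : ℤ)) ⌈N⌉₊, K (k / N) := by
    simp only [harg]
    exact sum_Icc_shift (F := fun k => K (k / N)) hj hjn hzero
  have hS1eq : ∑ i ∈ Finset.Icc 1 n,
      ((i : ℝ) / n - (j : ℝ) / n) * K (((i : ℝ) / n - (j : ℝ) / n) / b) = 0 := by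
    have h1 : ∀ i : ℕ, ((i : ℝ) / n - (j : ℝ) / n) * K (((i : ℝ) / n - (j : ℝ) / n) / b) =
        (fun k : ℤ => (k : ℝ) / n * K (k / N)) ((i : ℤ) - j) := by
      intro i
      rw [harg]
      push_cast
      rw [← sub_div]
    simp only [h1]
    rw [sum_Icc_shift (F := fun k : ℤ => (k : ℝ) / n * K (k / N)) hj hjn
      (fun k hk => by rw [hzero k hk, mul_zero])]
    refine sum_Icc_neg_self_of_odd (fun k => ?_) _
    push_cast
    rw [neg_div, neg_div, hK.symm]; ring
  rw [le_div_iff₀ hN0, ← hS0eq] at hS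
  set S0 := ∑ i ∈ Finset.Icc 1 n, K (((i : ℝ) / n - (j : ℝ) / n) / b) with hS0
  have hS0pos : 0 < S0 := by linarith
  have heq := hm.mul_sum_eq hS0pos hS1eq
  have hdiff : (m - μ ((j : ℝ) / n)) * S0 =
      ∑ i ∈ Finset.Icc 1 n, K (((i : ℝ) / n - (j : ℝ) / n) / b) * u i
      + ∑ i ∈ Finset.Icc 1 n, (μ ((i : ℝ) / n) - μ ((j : ℝ) / n)) *
          K (((i : ℝ) / n - (j : ℝ) / n) / b) := by
    rw [sub_mul, heq, hS0, Finset.mul_sum, ← Finset.sum_sub_distrib, ← Finset.sum_add_distrib]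
    exact Finset.sum_congr rfl fun i hi => by rw [hy i hi]; ring
  have hbias : |∑ i ∈ Finset.Icc 1 n, (μ ((i : ℝ) / n) - μ ((j : ℝ) / n)) *
      K (((i : ℝ) / n - (j : ℝ) / n) / b)| ≤ 3 * N * (η * W) := by
    have h1 : ∑ i ∈ Finset.Icc 1 n, (μ ((i : ℝ) / n) - μ ((j : ℝ) / n)) *
        K (((i : ℝ) / n - (j : ℝ) / n) / b) =
        ∑ i ∈ (Finset.Icc 1 n).filter (fun i : ℕ => |(i : ℝ) - j| ≤ N),
          (μ ((i : ℝ) / n) - μ ((j : ℝ) / n)) * K (((i : ℝ) / n - (j : ℝ) / n) / b) := by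
      symm
      refine Finset.sum_filter_of_ne fun i _ hne => ?_
      by_contra hcon
      exact hne (by rw [hK.eq_zero (one_lt_abs_div_sub_div hn hb hcon), mul_zero])
    rw [h1]
    refine (Finset.abs_sum_le_sum_abs _ _).trans ?_
    refine (Finset.sum_le_card_nsmul _ _ (η * W) fun i hi => ?_).trans ?_
    · rw [Finset.mem_filter] at hi
      rw [abs_mul]
      exact mul_le_mul (hη i hi.1 hi.2) (hW _) (abs_nonneg _) hη0
    · rw [nsmul_eq_mul]
      gcongr
      exact card_filter_abs_sub_le n j hN
  have h6 : |m - μ ((j : ℝ) / n)| * S0 ≤ δ * N + 3 * N * (η * W) := by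
    rw [← abs_of_pos hS0pos, ← abs_mul, hdiff]
    exact (abs_add_le _ _).trans (add_le_add hδ hbias)
  have h7 : |m - μ ((j : ℝ) / n)| * (1 / 2 * N) ≤ |m - μ ((j : ℝ) / n)| * S0 := by gcongr
  have h8 : |m - μ ((j : ℝ) / n)| * (1 / 2 * N) ≤ (2 * δ + 6 * W * η) * (1 / 2 * N) := by
    refine (h7.trans h6).trans (le_of_eq ?_)
    ring
  exact le_of_mul_le_mul_right h8 (by positivity)

end LocalLinear

/-! ### Window sums -/

section Windows

/-- A nonnegative sum over a window is squeezed between the sums over two intervals which start at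
multiples of `s`, so closeness to the mean on such intervals carries over to all windows. -/
lemma abs_sum_Ico_sub_le_of_blocks {n L s a : ℕ} {x w : ℕ → ℝ} {V D : ℝ} (hs : 1 ≤ s)
    (hsL : s ≤ L) (hsa : s ≤ a) (han : a + 2 * L ≤ n) (hx : ∀ i, 0 ≤ x i)
    (hw0 : ∀ i ∈ Finset.Ico (a - s) (a + 2 * L), 0 ≤ w i)
    (hwV : ∀ i ∈ Finset.Ico (a - s) (a + 2 * L), w i ≤ V)
    (hblock : ∀ g ∈ Finset.range (n / s + 1), ∀ ℓ ∈ ({L - s, L + s} : Finset ℕ),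
      |∑ i ∈ Finset.Ico (g * s) (g * s + ℓ) ∩ Finset.Icc 1 n, (x i - w i)| ≤ D) :
    |∑ i ∈ Finset.Ico a (a + L), (x i - w i)| ≤ D + s * V := by
  set g := a / s with hg
  have hga : g * s ≤ a := Nat.div_mul_le_self a s
  have hag : a < g * s + s := by
    have h1 : g * s + a % s = a := Nat.div_add_mod' a s
    have h2 := Nat.mod_lt a (show 0 < s by omega)
    omega
  have hg1 : 1 ≤ g := (Nat.le_div_iff_mul_le (by omega)).2 (by omega)
  have hgs : s ≤ g * s := Nat.le_mul_of_pos_left s (by omega)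
  have hg1n : g + 1 ≤ n / s :=
    (Nat.le_div_iff_mul_le (by omega)).2 (by rw [add_mul, one_mul]; omega)
  have hV : 0 ≤ V := by
    have hmem : a ∈ Finset.Ico (a - s) (a + 2 * L) := by rw [Finset.mem_Ico]; omega
    exact (hw0 a hmem).trans (hwV a hmem)
  have hcov := hblock g (by rw [Finset.mem_range]; omega) (L + s) (by simp)
  have hinn := hblock (g + 1) (by rw [Finset.mem_range]; omega) (L - s) (by simp)
  have hsub1 : Finset.Ico (g * s) (g * s + (L + s)) ∩ Finset.Icc 1 n =
      Finset.Ico (g * s) (g * s + (L + s)) := by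
    apply Finset.inter_eq_left.2
    intro i hi
    simp only [Finset.mem_Ico, Finset.mem_Icc] at hi ⊢
    omega
  have hend : (g + 1) * s + (L - s) = g * s + L := by rw [add_mul, one_mul]; omega
  have hsub2 : Finset.Ico ((g + 1) * s) ((g + 1) * s + (L - s)) ∩ Finset.Icc 1 n =
      Finset.Ico (g * s + s) (g * s + L) := by
    rw [hend, add_mul, one_mul]
    apply Finset.inter_eq_left.2
    intro i hi
    simp only [Finset.mem_Ico, Finset.mem_Icc] at hi ⊢
    omega
  rw [hsub1, Finset.sum_sub_distrib] at hcov
  rw [hsub2, Finset.sum_sub_distrib] at hinn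
  have hWC : Finset.Ico a (a + L) ⊆ Finset.Ico (g * s) (g * s + (L + s)) :=
    Finset.Ico_subset_Ico hga (by omega)
  have hIW : Finset.Ico (g * s + s) (g * s + L) ⊆ Finset.Ico a (a + L) :=
    Finset.Ico_subset_Ico (by omega) (by omega)
  have hextra : ∀ A B : Finset ℕ, A ⊆ B → B ⊆ Finset.Ico (a - s) (a + 2 * L) →
      B.card ≤ A.card + s → ∑ i ∈ B, w i ≤ ∑ i ∈ A, w i + s * V := by
    intro A B hAB hB hcard
    rw [← Finset.sum_sdiff hAB, add_comm]
    gcongr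
    refine (Finset.sum_le_card_nsmul _ _ V fun i hi =>
      hwV i (hB (Finset.sdiff_subset hi))).trans ?_
    rw [nsmul_eq_mul]
    gcongr
    rw [Finset.card_sdiff_of_subset hAB]
    omega
  have e1 := hextra _ _ hWC (Finset.Ico_subset_Ico (by omega) (by omega))
    (by rw [Nat.card_Ico, Nat.card_Ico]; omega)
  have e2 := hextra _ _ hIW (Finset.Ico_subset_Ico (by omega) (by omega))
    (by rw [Nat.card_Ico, Nat.card_Ico]; omega)
  have f1 : ∑ i ∈ Finset.Ico a (a + L), x i ≤
      ∑ i ∈ Finset.Ico (g * s) (g * s + (L + s)), x i :=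
    Finset.sum_le_sum_of_subset_of_nonneg hWC fun i _ _ => hx i
  have f2 : ∑ i ∈ Finset.Ico (g * s + s) (g * s + L), x i ≤ ∑ i ∈ Finset.Ico a (a + L), x i :=
    Finset.sum_le_sum_of_subset_of_nonneg hIW fun i _ _ => hx i
  rw [abs_le] at hcov hinn
  rw [Finset.sum_sub_distrib, abs_le]
  constructor <;> linarith

/-- Replacing `u` by `u - h` with `|h| ≤ τ` changes a sum of squares by a multiple of `τ`. -/
lemma abs_sum_sq_sub_sub_le {I : Finset ℕ} {u h w : ℕ → ℝ} {τ D V : ℝ} {L : ℕ}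
    (hI : I.card = L) (hτ0 : 0 ≤ τ) (hτ1 : τ ≤ 1) (hh : ∀ i ∈ I, |h i| ≤ τ)
    (hw : ∀ i ∈ I, w i ≤ V) (hD : |∑ i ∈ I, (u i ^ 2 - w i)| ≤ D) :
    |∑ i ∈ I, ((u i - h i) ^ 2 - w i)| ≤ D + τ * (D + L * V + 2 * L) := by
  have hpt : ∀ i ∈ I, |(u i - h i) ^ 2 - u i ^ 2| ≤ τ * u i ^ 2 + 2 * τ := by
    intro i hi
    have h1 := hh i hi
    have h2 : (u i - h i) ^ 2 - u i ^ 2 = h i * (h i - 2 * u i) := by ring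
    rw [h2, abs_mul]
    have h3 : |h i - 2 * u i| ≤ u i ^ 2 + 2 := by
      have h4 := abs_le.1 (h1.trans hτ1)
      rw [abs_le]
      constructor <;> nlinarith [sq_nonneg (u i - 1), sq_nonneg (u i + 1)]
    calc |h i| * |h i - 2 * u i| ≤ τ * (u i ^ 2 + 2) := by gcongr
      _ = _ := by ring
  have hsum : ∑ i ∈ I, u i ^ 2 ≤ D + L * V := by
    have h1 := (abs_le.1 hD).2
    rw [Finset.sum_sub_distrib] at h1
    have h2 := Finset.sum_le_card_nsmul I w V hw
    rw [hI, nsmul_eq_mul] at h2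
    linarith
  have hsplit : ∑ i ∈ I, ((u i - h i) ^ 2 - w i) =
      ∑ i ∈ I, (u i ^ 2 - w i) + ∑ i ∈ I, ((u i - h i) ^ 2 - u i ^ 2) := by
    rw [← Finset.sum_add_distrib]
    exact Finset.sum_congr rfl fun i _ => by ring
  rw [hsplit]
  refine (abs_add_le _ _).trans (add_le_add hD ?_)
  refine ((Finset.abs_sum_le_sum_abs _ _).trans (Finset.sum_le_sum hpt)).trans ?_
  rw [Finset.sum_add_distrib, ← Finset.mul_sum, Finset.sum_const, hI, nsmul_eq_mul]
  nlinarith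

/-- Uniform continuity of a function which is continuous on a compact set but for one point, where
it has a limit. -/
lemma exists_uniform_of_tendsto_nhdsWithin_diff {f : ℝ → ℝ} {s : Set ℝ} (hs : IsCompact s)
    {x y : ℝ} (hx : x ∈ s) (hf : ContinuousOn f (s \ {x}))
    (hlim : Tendsto f (𝓝[s \ {x}] x) (𝓝 y)) {κ : ℝ} (hκ : 0 < κ) :
    ∃ ρ : ℝ, 0 < ρ ∧ ∀ a ∈ s \ {x}, (|a - x| < ρ → |f a - y| ≤ κ) ∧
      ∀ c ∈ s \ {x}, |a - c| < ρ → |f a - f c| ≤ κ := by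
  have hc : ContinuousOn (Function.update f x y) s :=
    continuousOn_update_iff.2 ⟨hf, fun _ => hlim⟩
  have hu := hs.uniformContinuousOn_of_continuous hc
  rw [Metric.uniformContinuousOn_iff] at hu
  obtain ⟨ρ, hρ, h⟩ := hu κ hκ
  refine ⟨ρ, hρ, fun a ha => ⟨fun hax => ?_, fun c hc hac => ?_⟩⟩
  · have := h a ha.1 x hx hax
    rw [Function.update_self, Function.update_of_ne ha.2, Real.dist_eq] at this
    exact this.le
  · have := h a ha.1 c hc.1 hac
    rw [Function.update_of_ne ha.2, Function.update_of_ne hc.2, Real.dist_eq] at this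
    exact this.le

lemma exists_bound_of_tendsto_nhdsWithin_diff {f : ℝ → ℝ} {s : Set ℝ} (hs : IsCompact s)
    {x y : ℝ} (hf : ContinuousOn f (s \ {x}))
    (hlim : Tendsto f (𝓝[s \ {x}] x) (𝓝 y)) : ∃ V : ℝ, ∀ a ∈ s \ {x}, |f a| ≤ V := by
  have hc : ContinuousOn (Function.update f x y) s :=
    continuousOn_update_iff.2 ⟨hf, fun _ => hlim⟩
  obtain ⟨V, hV⟩ := hs.exists_bound_of_continuousOn hc
  refine ⟨V, fun a ha => ?_⟩
  have := hV a ha.1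
  rwa [Function.update_of_ne ha.2] at this

/-- A sum of `L` terms close to `c`, up to at most one exceptional term. The exception takes care of
the design point which may coincide with the jump, where the variance function is arbitrary. -/
lemma abs_sum_sub_card_mul_le {I J : Finset ℕ} {w : ℕ → ℝ} {c κ V : ℝ} {L : ℕ} (hJI : J ⊆ I)
    (hI : I.card = L) (hJ : J.card ≤ 1) (hκ : 0 ≤ κ) (hV : 0 ≤ V)
    (hw : ∀ i ∈ I \ J, |w i - c| ≤ κ) (hwJ : ∀ i ∈ J, |w i - c| ≤ V) :
    |∑ i ∈ I, w i - L * c| ≤ L * κ + V := by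
  have h1 : ∑ i ∈ I, w i - L * c = ∑ i ∈ I, (w i - c) := by
    rw [Finset.sum_sub_distrib, Finset.sum_const, hI, nsmul_eq_mul]
  rw [h1, ← Finset.sum_sdiff hJI]
  refine (abs_add_le _ _).trans (add_le_add ?_ ?_)
  · refine ((Finset.abs_sum_le_sum_abs _ _).trans (Finset.sum_le_card_nsmul _ _ κ hw)).trans ?_
    rw [nsmul_eq_mul, ← hI]
    gcongr
    exact Finset.sdiff_subset
  · refine ((Finset.abs_sum_le_sum_abs _ _).trans (Finset.sum_le_card_nsmul _ _ V hwJ)).trans ?_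
    rw [nsmul_eq_mul]
    have : (J.card : ℝ) ≤ 1 := by exact_mod_cast hJ
    nlinarith

end Windows

/-! ### Windows of squared residuals -/

section Residuals

variable {Ω : Type*} [MeasurableSpace Ω] {P : Measure Ω} {ε ε' : ℤ → Ω → ℝ}
  {r : ℕ} {brk : Fin (r + 2) → ℝ} {G : Fin (r + 1) → ℝ → (ℕ → ℝ) → ℝ} {e : ℕ → ℕ → Ω → ℝ}

lemma tendsto_natCast_rpow_atTop {α : ℝ} (hα : 0 < α) :
    Tendsto (fun n : ℕ => (n : ℝ) ^ α) atTop atTop :=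
  (tendsto_rpow_atTop hα).comp tendsto_natCast_atTop_atTop

lemma eventually_floor_rpow_le_mul {α : ℝ} (hα : α < 1) {x : ℝ} (hx : 0 < x) :
    ∀ᶠ n : ℕ in atTop, (⌊(n : ℝ) ^ α⌋₊ : ℝ) ≤ x * n := by
  have h1 : Tendsto (fun n : ℕ => (n : ℝ) ^ (-(1 - α))) atTop (𝓝 0) :=
    (tendsto_rpow_neg_atTop (by linarith)).comp tendsto_natCast_atTop_atTop
  filter_upwards [h1.eventually_le_const hx, eventually_gt_atTop 0] with n hn hn0
  have hn' : (0 : ℝ) < n := by exact_mod_cast hn0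
  refine (Nat.floor_le (by positivity)).trans ?_
  calc (n : ℝ) ^ α = (n : ℝ) ^ (-(1 - α)) * n := by
        nth_rewrite 3 [← Real.rpow_one (n : ℝ)]
        rw [← Real.rpow_add hn']; congr 1; ring
    _ ≤ x * n := by gcongr

/-- Averages of squared residuals over all windows which stay away from the end points are
uniformly close to the averages of the variance function. -/
theorem IsPLS.tendsto_measure_window_residual [IsProbabilityMeasure P] (h : IsPLS ε brk G e)
    (hε : IsInnovation P ε ε') (k : ℕ) {p : ℝ≥0∞} (hp : ((4 * k + 4 : ℕ) : ℝ≥0∞) ≤ p)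
    (hmom : HasBoundedMoments P ε brk G p) (hdep : HasGeometricDependence P ε ε' brk G p)
    {v : ℝ → ℝ} (hvar : HasVarianceFunction P e v) {α : ℝ} (hα0 : 0 < α) (hα1 : α < 1)
    (hα : 1 < α * (k + 2)) {μ : ℝ → ℝ} (hμ : ContinuousOn μ (Set.Icc 0 1))
    {Y : ℕ → ℕ → Ω → ℝ}
    (hY : ∀ n i : ℕ, 1 ≤ i → i ≤ n → ∀ ω, Y n i ω = μ ((i : ℝ) / n) + e n i ω)
    {K : ℝ → ℝ} (hK : IsKernel K) {b : ℕ → ℝ}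
    (hb6 : Tendsto (fun n : ℕ => (n : ℝ) * b n ^ 6) atTop (𝓝 0))
    (hb3 : Tendsto (fun n : ℕ => (n : ℝ) * b n ^ 3) atTop atTop)
    {μhat : ℕ → Ω → ℝ → ℝ}
    (hμhat : ∀ᶠ n : ℕ in atTop, ∀ ω, ∀ j : ℕ, 1 ≤ j → j ≤ n →
      IsLocalLinearEstimate K (b n) n (fun i => Y n i ω) ((j : ℝ) / n) (μhat n ω ((j : ℝ) / n)))
    {c V : ℝ} (hc : 0 < c) (hV : 0 ≤ V)
    (hvV : ∀ t ∈ Set.Icc (c / 2) (1 - c / 2), v t ≤ V) {κ : ℝ} (hκ : 0 < κ) :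
    Tendsto (fun n : ℕ => P {ω | ∃ a : ℕ, (n : ℝ) * c ≤ a ∧
      (a : ℝ) + ⌊(n : ℝ) ^ α⌋₊ ≤ n * (1 - c) + 1 ∧ κ * ⌊(n : ℝ) ^ α⌋₊ <
        |∑ i ∈ Finset.Ico a (a + ⌊(n : ℝ) ^ α⌋₊),
          (residual n (fun i => Y n i ω) (μhat n ω) i ^ 2 - v ((i : ℝ) / n))|}) atTop (𝓝 0) := by
  obtain ⟨W, hW0, hW⟩ := hK.exists_bound
  -- The error budget: `κ / 4` for the blocks, `κ / 4` for the boundary of the windows, and the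
  -- remaining half for the estimation of the mean.
  obtain ⟨R, hR⟩ := exists_nat_ge (4 * V / κ + 1)
  have hR1 : 1 ≤ R := by
    have : (1 : ℝ) ≤ R := le_trans (by simp; positivity) hR
    exact_mod_cast this
  have hRV : V ≤ κ / 4 * R := by
    have h1 : 4 * V / κ ≤ R := by linarith
    rw [div_le_iff₀ hκ] at h1
    linarith
  set τ : ℝ := min 1 (κ / 2 / (κ / 2 + V + 2)) with hτ
  have hτ0 : 0 < τ := lt_min one_pos (by positivity)
  have hτκ : τ * (κ / 2 + V + 2) ≤ κ / 2 := by
    have h1 : τ ≤ κ / 2 / (κ / 2 + V + 2) := min_le_right _ _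
    rwa [le_div_iff₀ (by positivity)] at h1
  set η : ℝ := τ / (12 * (W + 1)) with hη
  have hη0 : 0 < η := by positivity
  have hητ : 2 * (τ / 4) + 6 * W * η ≤ τ := by
    have h1 : 6 * W * η ≤ τ / 2 := by
      rw [hη, ← mul_div_assoc, div_le_iff₀ (by positivity)]
      nlinarith
    linarith
  have huc := isCompact_Icc.uniformContinuousOn_of_continuous hμ
  rw [Metric.uniformContinuousOn_iff] at huc
  obtain ⟨ρ, hρ, hμρ⟩ := huc η hη0
  have hB1 := h.tendsto_measure_block_sum hε k hp hmom hdep hvar hα0 hα1 hα hR1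
    (δ := κ / 4) (by positivity)
  have hp4 : ((2 * 1 + 2 : ℕ) : ℝ≥0∞) ≤ p := le_trans (by norm_cast; omega) hp
  have hB2 := h.tendsto_measure_kernel_sum hε hp4 hmom hdep hvar.mean_zero hK hb6 hb3
    (δ := τ / 4) (by positivity)
  have hB := hB1.add hB2
  rw [add_zero] at hB
  refine tendsto_of_tendsto_of_tendsto_of_le_of_le' tendsto_const_nhds hB
    (Eventually.of_forall fun _ => zero_le) ?_
  have hb0 := tendsto_bandwidth_zero hb6
  have hnb := tendsto_mul_bandwidth_pow hb6 hb3 (m := 1) (by norm_num)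
  simp only [pow_one] at hnb
  have hriem := (hK.tendsto_riemann_sum.comp hnb).eventually_const_le
    (show (1 / 2 : ℝ) < 1 by norm_num)
  have hnc : Tendsto (fun n : ℕ => (n : ℝ) * (c / 2)) atTop atTop :=
    tendsto_natCast_atTop_atTop.atTop_mul_const (by positivity)
  filter_upwards [hμhat, eventually_bandwidth_pos hb3, hnb.eventually_ge_atTop 1, hriem,
    hb0.eventually_lt_const hρ, hb0.eventually_le_const (show 0 < c / 2 by positivity),
    hnc.eventually_ge_atTop 2, eventually_gt_atTop 0,
    (tendsto_natCast_rpow_atTop hα0).eventually_ge_atTop (R : ℝ),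
    eventually_floor_rpow_le_mul hα1 (show 0 < c / 4 by positivity)]
    with n hest hbpos hN1 hS hbρ hbc hnc1 hn hLR hLn
  simp only [Function.comp_apply] at hS
  set L := ⌊(n : ℝ) ^ α⌋₊ with hL
  set s := L / R with hs
  have hn' : (0 : ℝ) < n := by exact_mod_cast hn
  have hnc0 : 0 < (n : ℝ) * c := by positivity
  have hRL : R ≤ L := Nat.le_floor hLR
  have hs1 : 1 ≤ s := (Nat.one_le_div_iff (by omega)).2 hRL
  have hsL : s ≤ L := Nat.div_le_self _ _
  have hsV : s * V ≤ κ / 4 * L := by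
    have h1 : (s : ℝ) * R ≤ L := by exact_mod_cast Nat.div_mul_le_self L R
    calc s * V ≤ s * (κ / 4 * R) := by gcongr
      _ = κ / 4 * (s * R) := by ring
      _ ≤ κ / 4 * L := by gcongr
  have hL1 : (1 : ℝ) ≤ L := by exact_mod_cast (show 1 ≤ L by omega)
  refine (measure_mono ?_).trans (measure_union_le _ _)
  rintro ω ⟨a, ha1, ha2, hdev⟩
  by_contra hgood
  rw [Set.mem_union, not_or] at hgood
  obtain ⟨hg1, hg2⟩ := hgood
  simp only [Set.mem_ofPred_eq, not_exists, not_and, not_le] at hg1 hg2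
  have hsLr : (s : ℝ) ≤ L := by exact_mod_cast hsL
  have haL : 2 * L ≤ a := by
    have : (2 : ℝ) * L ≤ a := by linarith
    exact_mod_cast this
  have han : a + 2 * L ≤ n := by
    have : (a : ℝ) + 2 * L ≤ n := by linarith
    exact_mod_cast this
  have hin : ∀ i ∈ Finset.Ico (a - s) (a + 2 * L),
      (i : ℝ) / n ∈ Set.Icc (c / 2) (1 - c / 2) := by
    intro i hi
    rw [Finset.mem_Ico] at hi
    have h1 : (a : ℝ) ≤ i + s := by exact_mod_cast (show a ≤ i + s by omega)
    have h2 : (i : ℝ) + 1 ≤ a + 2 * L := by exact_mod_cast (show i + 1 ≤ a + 2 * L by omega)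
    constructor
    · rw [le_div_iff₀ hn']; linarith
    · rw [div_le_iff₀ hn']; linarith
  have hw : ∀ i ∈ Finset.Ico (a - s) (a + 2 * L), v ((i : ℝ) / n) ≤ V := fun i hi =>
    hvV _ (hin i hi)
  have hblock := abs_sum_Ico_sub_le_of_blocks (x := fun i => e n i ω ^ 2)
    (w := fun i => v ((i : ℝ) / n)) hs1 hsL (by omega) han (fun i => sq_nonneg _)
    (fun i hi => by
      have h1 := hin i hi
      exact (hvar.pos _ ⟨by linarith [h1.1], by linarith [h1.2]⟩).le) hw
    (fun g hg ℓ hℓ => (hg1 g hg ℓ hℓ).le)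
  have hsub : Finset.Ico a (a + L) ⊆ Finset.Ico (a - s) (a + 2 * L) :=
    Finset.Ico_subset_Ico (by omega) (by omega)
  have hh : ∀ i ∈ Finset.Ico a (a + L), |μhat n ω ((i : ℝ) / n) - μ ((i : ℝ) / n)| ≤ τ := by
    intro j hj
    rw [Finset.mem_Ico] at hj
    have hceil := Nat.ceil_lt_add_one (show 0 ≤ (n : ℝ) * b n by linarith)
    have hNc : (n : ℝ) * b n ≤ n * (c / 2) := by gcongr
    have hja : (a : ℝ) ≤ j := by exact_mod_cast hj.1
    have hja2 : (j : ℝ) + 1 ≤ a + L := by exact_mod_cast (show j + 1 ≤ a + L by omega)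
    have hj1 : ⌈(n : ℝ) * b n⌉₊ < j := by
      have : (⌈(n : ℝ) * b n⌉₊ : ℝ) < j := by linarith
      exact_mod_cast this
    have hj2 : j + ⌈(n : ℝ) * b n⌉₊ ≤ n := by
      have : (j : ℝ) + ⌈(n : ℝ) * b n⌉₊ ≤ n := by linarith
      exact_mod_cast this
    have hjmem : j ∈ Finset.Icc 1 n := by rw [Finset.mem_Icc]; omega
    have hunit : ∀ i ∈ Finset.Icc 1 n, (i : ℝ) / n ∈ Set.Icc (0 : ℝ) 1 := by
      intro i hi
      exact ⟨by positivity, (div_le_one hn').2 (by exact_mod_cast (Finset.mem_Icc.1 hi).2)⟩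
    refine (abs_localLinear_sub_le hK hW hn hbpos hN1 hS hj1 hj2 (u := fun i => e n i ω)
      (fun i hi => hY n i (Finset.mem_Icc.1 hi).1 (Finset.mem_Icc.1 hi).2 ω) (η := η)
      (δ := τ / 4) ?_ (hg2 j hjmem).le (hest ω j (by omega) (by omega))).trans hητ
    intro i hi hij
    refine (hμρ _ (hunit i hi) _ (hunit j hjmem) ?_).le
    rw [Real.dist_eq, ← sub_div, abs_div, abs_of_pos hn', div_lt_iff₀ hn']
    have := mul_lt_mul_of_pos_left hbρ hn'
    linarith
  have hcard : (Finset.Ico a (a + L)).card = L := by rw [Nat.card_Ico, Nat.add_sub_cancel_left]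
  have hfin := abs_sum_sq_sub_sub_le (u := fun i => e n i ω)
    (h := fun i => μhat n ω ((i : ℝ) / n) - μ ((i : ℝ) / n)) (w := fun i => v ((i : ℝ) / n))
    hcard hτ0.le (min_le_left _ _) hh (fun i hi => hw i (hsub hi))
    (D := κ / 2 * L) (hblock.trans (by linarith))
  have hres : ∑ i ∈ Finset.Ico a (a + L),
      (residual n (fun i => Y n i ω) (μhat n ω) i ^ 2 - v ((i : ℝ) / n)) =
      ∑ i ∈ Finset.Ico a (a + L),
        ((e n i ω - (μhat n ω ((i : ℝ) / n) - μ ((i : ℝ) / n))) ^ 2 - v ((i : ℝ) / n)) := by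
    refine Finset.sum_congr rfl fun i hi => ?_
    rw [Finset.mem_Ico] at hi
    have hi1 : 1 ≤ i := by omega
    have hi2 : i ≤ n := by omega
    rw [residual, if_pos ⟨hi1, hi2⟩, hY n i hi1 hi2 ω]
    ring
  rw [hres] at hdev
  have h9 : τ * (κ / 2 * L + L * V + 2 * L) ≤ κ / 2 * L := by
    calc τ * (κ / 2 * L + L * V + 2 * L) = τ * (κ / 2 + V + 2) * L := by ring
      _ ≤ κ / 2 * L := by gcongr
  linarith

end Residuals

/-! ### The maximiser of the window statistic -/

section Argmax

lemma abs_windowStat_sub_le {L i : ℕ} {u : ℕ → ℝ} {c₁ c₂ x : ℝ} (hL : 0 < L)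
    (h1 : |∑ j ∈ Finset.Ico (i + 1 - L) (i + 1), u j ^ 2 - L * c₁| ≤ L * x)
    (h2 : |∑ j ∈ Finset.Ico i (i + L), u j ^ 2 - L * c₂| ≤ L * x) :
    |windowStat L u i - (c₁ - c₂)| ≤ 2 * x := by
  have hL' : (0 : ℝ) < L := by exact_mod_cast hL
  have e1 : Finset.Icc (i + 1 - L) i = Finset.Ico (i + 1 - L) (i + 1) := by
    ext; simp only [Finset.mem_Icc, Finset.mem_Ico]; omega
  have e2 : Finset.Icc i (i + L - 1) = Finset.Ico i (i + L) := by
    ext; simp only [Finset.mem_Icc, Finset.mem_Ico]; omega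
  rw [windowStat, e1, e2]
  have h3 : 1 / (L : ℝ) * (∑ j ∈ Finset.Ico (i + 1 - L) (i + 1), u j ^ 2 -
      ∑ j ∈ Finset.Ico i (i + L), u j ^ 2) - (c₁ - c₂) =
      ((∑ j ∈ Finset.Ico (i + 1 - L) (i + 1), u j ^ 2 - L * c₁) -
        (∑ j ∈ Finset.Ico i (i + L), u j ^ 2 - L * c₂)) / L := by
    field_simp
    ring
  rw [h3, abs_div, abs_of_pos hL', div_le_iff₀ hL']
  refine (abs_sub _ _).trans ?_
  linarith

/-- If all window averages of `u ^ 2` in the interior are close to those of `v`, then the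
maximiser of the window statistic is at distance less than `L` from the jump. -/
lemma abs_argmax_sub_lt {n L k : ℕ} {u : ℕ → ℝ} {v : ℝ → ℝ} {ζ tv l r κ ρ V : ℝ}
    (hζ : 0 < ζ) (htv : tv ∈ Set.Icc ζ (1 - ζ)) (hκ : 0 < κ) (hjump : 12 * κ < |l - r|)
    (hl : ∀ a ∈ Set.Icc (ζ / 4) tv \ {tv}, (|a - tv| < ρ → |v a - l| ≤ κ) ∧
      ∀ c ∈ Set.Icc (ζ / 4) tv \ {tv}, |a - c| < ρ → |v a - v c| ≤ κ)
    (hr : ∀ a ∈ Set.Icc tv (1 - ζ / 4) \ {tv}, (|a - tv| < ρ → |v a - r| ≤ κ) ∧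
      ∀ c ∈ Set.Icc tv (1 - ζ / 4) \ {tv}, |a - c| < ρ → |v a - v c| ≤ κ)
    (hV0 : 0 ≤ V) (hVl : ∀ a ∈ Set.Icc (ζ / 4) (1 - ζ / 4), |v a - l| ≤ V)
    (hVr : ∀ a ∈ Set.Icc (ζ / 4) (1 - ζ / 4), |v a - r| ≤ V)
    (hn : 0 < n) (hL : 0 < L) (hLζ : (L : ℝ) ≤ ζ / 8 * n) (hnζ : 24 ≤ n * ζ)
    (hLρ : (L : ℝ) < ρ * n) (hLV : V ≤ κ * L)
    (hgood : ∀ a : ℕ, (n : ℝ) * (ζ / 2) ≤ a → (a : ℝ) + L ≤ n * (1 - ζ / 2) + 1 →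
      |∑ i ∈ Finset.Ico a (a + L), (u i ^ 2 - v ((i : ℝ) / n))| ≤ κ * L)
    (hk : IsWindowArgmax ζ n L u k) : |(k : ℝ) - n * tv| < L := by
  have hn' : (0 : ℝ) < n := by exact_mod_cast hn
  have hnζ0 : 0 < (n : ℝ) * ζ := by positivity
  have hζ2 : ζ ≤ 1 / 2 := by linarith [htv.1, htv.2]
  have hfl := Nat.floor_le (show 0 ≤ (n : ℝ) * ζ by positivity)
  have hfl' := Nat.lt_floor_add_one ((n : ℝ) * ζ)
  have hfn : ⌊(n : ℝ) * ζ⌋₊ ≤ n := by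
    have : (⌊(n : ℝ) * ζ⌋₊ : ℝ) ≤ n := by nlinarith
    exact_mod_cast this
  have hrange : ∀ i ∈ Set.Icc ⌊(n : ℝ) * ζ⌋₊ (n - ⌊(n : ℝ) * ζ⌋₊ + 1),
      (n : ℝ) * ζ - 1 ≤ i ∧ (i : ℝ) ≤ n - n * ζ + 2 := by
    rintro i ⟨hi1, hi2⟩
    have h1 : (⌊(n : ℝ) * ζ⌋₊ : ℝ) ≤ i := by exact_mod_cast hi1
    have h2 : (i : ℝ) + ⌊(n : ℝ) * ζ⌋₊ ≤ n + 1 := by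
      exact_mod_cast (show i + ⌊(n : ℝ) * ζ⌋₊ ≤ n + 1 by omega)
    constructor <;> linarith
  -- both windows of an admissible point stay away from the end points
  have key : ∀ i ∈ Set.Icc ⌊(n : ℝ) * ζ⌋₊ (n - ⌊(n : ℝ) * ζ⌋₊ + 1), ∀ c₁ c₂ : ℝ,
      |∑ j ∈ Finset.Ico (i + 1 - L) (i + 1), v ((j : ℝ) / n) - L * c₁| ≤ L * κ + V →
      |∑ j ∈ Finset.Ico i (i + L), v ((j : ℝ) / n) - L * c₂| ≤ L * κ + V →
      |windowStat L u i - (c₁ - c₂)| ≤ 6 * κ := by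
    intro i hi c₁ c₂ h1 h2
    obtain ⟨hi1, hi2⟩ := hrange i hi
    have hLi : L ≤ i := by
      have : (L : ℝ) ≤ i := by linarith
      exact_mod_cast this
    have hcast : ((i + 1 - L : ℕ) : ℝ) = i + 1 - L := by
      rw [Nat.cast_sub (by omega)]; push_cast; ring
    have g1 := hgood (i + 1 - L) (by rw [hcast]; linarith) (by rw [hcast]; linarith)
    have g2 := hgood i (by linarith) (by linarith)
    rw [show i + 1 - L + L = i + 1 by omega, Finset.sum_sub_distrib] at g1
    rw [Finset.sum_sub_distrib] at g2
    have hx : ∀ A B C : ℝ, |A - B| ≤ κ * L → |B - C| ≤ L * κ + V → |A - C| ≤ L * (3 * κ) := by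
      intro A B C hAB hBC
      have := abs_sub_le A B C
      linarith
    have := abs_windowStat_sub_le hL (hx _ _ _ g1 h1) (hx _ _ _ g2 h2)
    linarith
  -- near the jump the statistic is close to the jump size
  obtain ⟨i₀, hi₀⟩ : ∃ i₀ : ℕ, i₀ = ⌊(n : ℝ) * tv⌋₊ := ⟨_, rfl⟩
  have htv0 : 0 ≤ (n : ℝ) * tv := mul_nonneg hn'.le (by linarith [htv.1])
  have h0a : (i₀ : ℝ) ≤ n * tv := hi₀ ▸ Nat.floor_le htv0
  have h0b : n * tv < (i₀ : ℝ) + 1 := hi₀ ▸ Nat.lt_floor_add_one _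
  have hntv1 : (n : ℝ) * ζ ≤ n * tv := by gcongr; exact htv.1
  have hntv2 : (n : ℝ) * tv ≤ n * (1 - ζ) := by gcongr; exact htv.2
  have h0mem : i₀ ∈ Set.Icc ⌊(n : ℝ) * ζ⌋₊ (n - ⌊(n : ℝ) * ζ⌋₊ + 1) := by
    constructor
    · rw [hi₀]; exact Nat.floor_le_floor hntv1
    · have : (i₀ : ℝ) + ⌊(n : ℝ) * ζ⌋₊ ≤ n := by linarith
      have : i₀ + ⌊(n : ℝ) * ζ⌋₊ ≤ n := by exact_mod_cast this
      omega
  have hclose : ∀ {x y : ℝ}, |x - y| ≤ L → |x / n - y / n| < ρ := by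
    intro x y hxy
    rw [← sub_div, abs_div, abs_of_pos hn', div_lt_iff₀ hn']
    linarith
  have htvn : (n : ℝ) * tv / n = tv := by field_simp
  have h0L : L ≤ i₀ := by
    have : (L : ℝ) ≤ i₀ := by linarith
    exact_mod_cast this
  have hstat0 := key i₀ h0mem l r
    (by
      refine abs_sum_sub_card_mul_le (J := {i₀}) ?_ ?_ (by simp) hκ.le hV0 ?_ ?_
      · rw [Finset.singleton_subset_iff, Finset.mem_Ico]; omega
      · rw [Nat.card_Ico]; omega
      · intro j hj
        rw [Finset.mem_sdiff, Finset.mem_Ico, Finset.mem_singleton] at hj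
        have h1 : (j : ℝ) + 1 ≤ i₀ := by exact_mod_cast (show j + 1 ≤ i₀ by omega)
        have h2 : (i₀ : ℝ) + 1 ≤ j + L := by exact_mod_cast (show i₀ + 1 ≤ j + L by omega)
        have hjt : (j : ℝ) / n < tv := by rw [div_lt_iff₀ hn']; linarith
        refine (hl _ ⟨⟨?_, hjt.le⟩, hjt.ne⟩).1 ?_
        · rw [le_div_iff₀ hn']; linarith
        · rw [← htvn]
          exact hclose (by rw [abs_le]; constructor <;> linarith)
      · intro j hj
        rw [Finset.mem_singleton] at hj
        subst hj
        refine hVl _ ⟨?_, ?_⟩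
        · rw [le_div_iff₀ hn']; linarith
        · rw [div_le_iff₀ hn']; linarith)
    (by
      refine abs_sum_sub_card_mul_le (J := {i₀}) ?_ ?_ (by simp) hκ.le hV0 ?_ ?_
      · rw [Finset.singleton_subset_iff, Finset.mem_Ico]; omega
      · rw [Nat.card_Ico]; omega
      · intro j hj
        rw [Finset.mem_sdiff, Finset.mem_Ico, Finset.mem_singleton] at hj
        have h1 : (i₀ : ℝ) + 1 ≤ j := by exact_mod_cast (show i₀ + 1 ≤ j by omega)
        have h2 : (j : ℝ) + 1 ≤ i₀ + L := by exact_mod_cast (show j + 1 ≤ i₀ + L by omega)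
        have hjt : tv < (j : ℝ) / n := by rw [lt_div_iff₀ hn']; linarith
        refine (hr _ ⟨⟨hjt.le, ?_⟩, hjt.ne'⟩).1 ?_
        · rw [div_le_iff₀ hn']; linarith
        · rw [← htvn]
          exact hclose (by rw [abs_le]; constructor <;> linarith)
      · intro j hj
        rw [Finset.mem_singleton] at hj
        subst hj
        refine hVr _ ⟨?_, ?_⟩
        · rw [le_div_iff₀ hn']; linarith
        · rw [div_le_iff₀ hn']; linarith)
  have hmax : |windowStat L u i₀| ≤ |windowStat L u k| := hk.2 h0mem
  -- away from the jump it is close to zero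
  by_contra! hfar
  obtain ⟨hk1, hk2⟩ := hrange k hk.1
  have hkL : L ≤ k := by
    have : (L : ℝ) ≤ k := by linarith
    exact_mod_cast this
  have hstatk : |windowStat L u k - (v ((k : ℝ) / n) - v ((k : ℝ) / n))| ≤ 6 * κ := by
    have hside : ∀ j ∈ Finset.Ico (k + 1 - L) (k + L),
        |v ((j : ℝ) / n) - v ((k : ℝ) / n)| ≤ κ := by
      intro j hj
      rw [Finset.mem_Ico] at hj
      have h1 : (k : ℝ) + 1 ≤ j + L := by exact_mod_cast (show k + 1 ≤ j + L by omega)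
      have h2 : (j : ℝ) + 1 ≤ k + L := by exact_mod_cast (show j + 1 ≤ k + L by omega)
      have hjk : |(j : ℝ) / n - (k : ℝ) / n| < ρ :=
        hclose (by rw [abs_le]; constructor <;> linarith)
      rcases le_abs.1 hfar with hfar | hfar
      · refine (hr _ ⟨⟨?_, ?_⟩, ?_⟩).2 _ ⟨⟨?_, ?_⟩, ?_⟩ hjk
        · rw [le_div_iff₀ hn']; linarith
        · rw [div_le_iff₀ hn']; linarith
        · have : tv < (j : ℝ) / n := by rw [lt_div_iff₀ hn']; linarith
          exact this.ne'
        · rw [le_div_iff₀ hn']; linarith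
        · rw [div_le_iff₀ hn']; linarith
        · have : tv < (k : ℝ) / n := by rw [lt_div_iff₀ hn']; linarith
          exact this.ne'
      · refine (hl _ ⟨⟨?_, ?_⟩, ?_⟩).2 _ ⟨⟨?_, ?_⟩, ?_⟩ hjk
        · rw [le_div_iff₀ hn']; linarith
        · rw [div_le_iff₀ hn']; linarith
        · have : (j : ℝ) / n < tv := by rw [div_lt_iff₀ hn']; linarith
          exact this.ne
        · rw [le_div_iff₀ hn']; linarith
        · rw [div_le_iff₀ hn']; linarith
        · have : (k : ℝ) / n < tv := by rw [div_lt_iff₀ hn']; linarith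
          exact this.ne
    refine key k hk.1 _ _ ?_ ?_
    · refine abs_sum_sub_card_mul_le (Finset.empty_subset _) ?_ (by simp) hκ.le hV0 ?_ (by simp)
      · rw [Nat.card_Ico]; omega
      · intro j hj
        rw [Finset.sdiff_empty, Finset.mem_Ico] at hj
        exact hside j (by rw [Finset.mem_Ico]; omega)
    · refine abs_sum_sub_card_mul_le (Finset.empty_subset _) ?_ (by simp) hκ.le hV0 ?_ (by simp)
      · rw [Nat.card_Ico]; omega
      · intro j hj
        rw [Finset.sdiff_empty, Finset.mem_Ico] at hj
        exact hside j (by rw [Finset.mem_Ico]; omega)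
  rw [sub_self, sub_zero] at hstatk
  have h5 := abs_sub_abs_le_abs_sub (l - r) (windowStat L u i₀)
  rw [abs_sub_comm (l - r) (windowStat L u i₀)] at h5
  linarith

end Argmax

end PLS

end

theorem mainTheorem9
    {Ω : Type*} [MeasurableSpace Ω] (P : Measure Ω) [IsProbabilityMeasure P]
    -- innovations, break points, filters, errors
    (ε ε' : ℤ → Ω → ℝ) (hε : PLS.IsInnovation P ε ε')
    {r : ℕ} (brk : Fin (r + 2) → ℝ) (G : Fin (r + 1) → ℝ → (ℕ → ℝ) → ℝ)
    (e : ℕ → ℕ → Ω → ℝ) (hpls : PLS.IsPLS ε brk G e)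
    (ι : ℝ) (hι : 8 < ι)
    (hlip : PLS.IsStochLipschitz P ε brk G (ENNReal.ofReal ι))
    (v : ℝ → ℝ) (hvar : PLS.HasVarianceFunction P e v)
    (hmom : PLS.HasBoundedMoments P ε brk G (ENNReal.ofReal ι))
    (hdep : PLS.HasGeometricDependence P ε ε' brk G (ENNReal.ofReal ι))
    -- mean function and observations
    (μ : ℝ → ℝ) (hμ : PLS.HasLipschitzSecondDeriv μ (Set.Icc 0 1))
    (Y : ℕ → ℕ → Ω → ℝ)
    (hY : ∀ n i : ℕ, 1 ≤ i → i ≤ n → ∀ ω, Y n i ω = μ ((i : ℝ) / n) + e n i ω)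
    -- change point of the variance
    (ζ : ℝ) (hζ : 0 < ζ) (tv : ℝ) (htv : tv ∈ Set.Icc ζ (1 - ζ))
    (hjump : PLS.HasJumpAt v tv)
    (hleft : PLS.HasLipschitzSecondDeriv v (Set.Ioo 0 tv))
    (hright : PLS.HasLipschitzSecondDeriv v (Set.Ioo tv 1))
    -- kernel, bandwidths, local linear estimator of the mean
    (K : ℝ → ℝ) (hK : PLS.IsKernel K)
    (b : ℕ → ℝ) (hb6 : Tendsto (fun n : ℕ => (n : ℝ) * b n ^ 6) atTop (𝓝 0))
    (hb3 : Tendsto (fun n : ℕ => (n : ℝ) * b n ^ 3) atTop atTop)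
    (μhat : ℕ → Ω → ℝ → ℝ)
    (hμhat : ∀ᶠ n : ℕ in atTop, ∀ ω, ∀ j : ℕ, 1 ≤ j → j ≤ n →
      PLS.IsLocalLinearEstimate K (b n) n (fun i => Y n i ω) ((j : ℝ) / n)
        (μhat n ω ((j : ℝ) / n)))
    -- window length and change point estimator `kstar n / n`
    (α : ℝ) (hα : 4 / ι < α) (hα' : α < 1 / 2)
    (kstar : ℕ → Ω → ℕ)
    (hkstar : ∀ n ω, PLS.IsWindowArgmax ζ n ⌊(n : ℝ) ^ α⌋₊
      (PLS.residual n (fun i => Y n i ω) (μhat n ω)) (kstar n ω)) :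
    PLS.IsBigOp P (fun n ω => (kstar n ω : ℝ) / n - tv)
      (fun n => (n : ℝ) ^ (-(1 - α))) := by
  have hα0 : 0 < α := lt_trans (by positivity) hα
  -- Moments of order `2 * (k + 1)` of the squared errors are available, and the union bound over
  -- about `n ^ (1 - α)` blocks needs `1 - α < α * (k + 1)`.
  obtain ⟨k, hk1, hk2⟩ : ∃ k : ℕ, (4 * k + 4 : ℝ) ≤ ι ∧ ι < 4 * (k + 2) := by
    have h1 : 1 ≤ ⌊ι / 4⌋₊ := Nat.le_floor (by push_cast; linarith)
    have h2 := Nat.floor_le (show 0 ≤ ι / 4 by linarith)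
    have h3 := Nat.lt_floor_add_one (ι / 4)
    have h4 : ((⌊ι / 4⌋₊ - 1 : ℕ) : ℝ) = ⌊ι / 4⌋₊ - 1 := by rw [Nat.cast_sub h1]; simp
    refine ⟨⌊ι / 4⌋₊ - 1, ?_, ?_⟩ <;> rw [h4] <;> linarith
  have hp : ((4 * k + 4 : ℕ) : ℝ≥0∞) ≤ ENNReal.ofReal ι := by
    rw [← ENNReal.ofReal_natCast]
    exact ENNReal.ofReal_le_ofReal (by push_cast; exact hk1)
  have hαk : 1 < α * (k + 2) := by
    have hι0 : 0 < ι := by linarith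
    rw [div_lt_iff₀ hι0] at hα
    nlinarith
  obtain ⟨l, r', hlr, hl, hr⟩ := hjump
  have htv0 : ζ ≤ tv := htv.1
  have htv1 : tv ≤ 1 - ζ := htv.2
  have hcl : IsCompact (Set.Icc (ζ / 4) tv) := isCompact_Icc
  have hcr : IsCompact (Set.Icc tv (1 - ζ / 4)) := isCompact_Icc
  have hfl : ContinuousOn v (Set.Icc (ζ / 4) tv \ {tv}) := hleft.1.continuousOn.mono
    fun x hx => ⟨by linarith [hx.1.1], lt_of_le_of_ne hx.1.2 hx.2⟩
  have hfr : ContinuousOn v (Set.Icc tv (1 - ζ / 4) \ {tv}) := hright.1.continuousOn.mono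
    fun x hx => ⟨lt_of_le_of_ne hx.1.1 (Ne.symm hx.2), by linarith [hx.1.2]⟩
  have hll : Tendsto v (𝓝[Set.Icc (ζ / 4) tv \ {tv}] tv) (𝓝 l) :=
    hl.mono_left (nhdsWithin_mono _ fun x hx => lt_of_le_of_ne hx.1.2 hx.2)
  have hlr' : Tendsto v (𝓝[Set.Icc tv (1 - ζ / 4) \ {tv}] tv) (𝓝 r') :=
    hr.mono_left (nhdsWithin_mono _ fun x hx => lt_of_le_of_ne hx.1.1 (Ne.symm hx.2))
  obtain ⟨V, hV0, hV⟩ : ∃ V : ℝ, 0 ≤ V ∧ ∀ t ∈ Set.Icc (ζ / 4) (1 - ζ / 4), |v t| ≤ V := by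
    obtain ⟨V₁, h1⟩ := PLS.exists_bound_of_tendsto_nhdsWithin_diff hcl hfl hll
    obtain ⟨V₂, h2⟩ := PLS.exists_bound_of_tendsto_nhdsWithin_diff hcr hfr hlr'
    refine ⟨max |v tv| (max V₁ V₂), le_max_of_le_left (abs_nonneg _), fun t ht => ?_⟩
    rcases lt_trichotomy t tv with h | h | h
    · exact (h1 t ⟨⟨ht.1, h.le⟩, h.ne⟩).trans (le_max_of_le_right (le_max_left _ _))
    · rw [h]; exact le_max_left _ _
    · exact (h2 t ⟨⟨h.le, ht.2⟩, h.ne'⟩).trans (le_max_of_le_right (le_max_right _ _))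
  set κ : ℝ := |l - r'| / 13 with hκdef
  have hlr0 : 0 < |l - r'| := abs_pos.2 (sub_ne_zero.2 hlr)
  have hκ : 0 < κ := by positivity
  have hκj : 12 * κ < |l - r'| := by rw [hκdef]; linarith
  obtain ⟨ρ₁, hρ₁, hu₁⟩ := PLS.exists_uniform_of_tendsto_nhdsWithin_diff hcl
    (Set.right_mem_Icc.2 (by linarith)) hfl hll hκ
  obtain ⟨ρ₂, hρ₂, hu₂⟩ := PLS.exists_uniform_of_tendsto_nhdsWithin_diff hcr
    (Set.left_mem_Icc.2 (by linarith)) hfr hlr' hκ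
  set ρ := min ρ₁ ρ₂ with hρdef
  have hρ : 0 < ρ := lt_min hρ₁ hρ₂
  have hbad := hpls.tendsto_measure_window_residual hε k hp hmom hdep hvar hα0 (by linarith) hαk
    hμ.1.continuousOn hY hK hb6 hb3 hμhat (c := ζ / 2) (by positivity) hV0
    (fun t ht => (le_abs_self _).trans (hV t ⟨by linarith [ht.1], by linarith [ht.2]⟩)) hκ
  have hfloor : Tendsto (fun n : ℕ => (⌊(n : ℝ) ^ α⌋₊ : ℝ)) atTop atTop :=
    tendsto_natCast_atTop_atTop.comp
      (tendsto_nat_floor_atTop.comp (PLS.tendsto_natCast_rpow_atTop hα0))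
  intro δ hδ
  refine ⟨1, one_pos, ?_⟩
  filter_upwards [hbad.eventually_le_const (ENNReal.ofReal_pos.2 hδ), eventually_gt_atTop 0,
    hfloor.eventually_ge_atTop 1, hfloor.eventually_ge_atTop ((V + |l| + |r'|) / κ),
    PLS.eventually_floor_rpow_le_mul (show α < 1 by linarith) (show 0 < ζ / 8 by positivity),
    PLS.eventually_floor_rpow_le_mul (show α < 1 by linarith) (show 0 < ρ / 2 by positivity),
    (tendsto_natCast_atTop_atTop.atTop_mul_const hζ : Tendsto (fun n : ℕ => (n : ℝ) * ζ) _ _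
      ).eventually_ge_atTop 24] with n hn hn0 hL1 hLV hLζ hLρ hnζ
  refine le_trans (measure_mono ?_) hn
  intro ω hω
  by_contra hgood
  simp only [Set.mem_ofPred_eq, not_exists, not_and, not_lt] at hω hgood
  have hn' : (0 : ℝ) < n := by exact_mod_cast hn0
  have hdist := PLS.abs_argmax_sub_lt (ρ := ρ) (V := V + |l| + |r'|) hζ htv hκ hκj
    (fun a ha => ⟨fun h => (hu₁ a ha).1 (h.trans_le (min_le_left _ _)),
      fun c hc h => (hu₁ a ha).2 c hc (h.trans_le (min_le_left _ _))⟩)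
    (fun a ha => ⟨fun h => (hu₂ a ha).1 (h.trans_le (min_le_right _ _)),
      fun c hc h => (hu₂ a ha).2 c hc (h.trans_le (min_le_right _ _))⟩)
    (by positivity)
    (fun a ha => (abs_sub _ _).trans (by linarith [hV a ha, abs_nonneg r']))
    (fun a ha => (abs_sub _ _).trans (by linarith [hV a ha, abs_nonneg l]))
    hn0 (by exact_mod_cast hL1) hLζ hnζ
    (hLρ.trans_lt (by have := mul_pos hρ hn'; linarith))
    (by rwa [div_le_iff₀' hκ] at hLV)
    hgood (hkstar n ω)
  have h1 : (kstar n ω : ℝ) / n - tv = ((kstar n ω : ℝ) - n * tv) / n := by field_simp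
  rw [h1, abs_div, abs_of_pos hn', one_mul, lt_div_iff₀ hn'] at hω
  have h2 : (n : ℝ) ^ (-(1 - α)) * n = (n : ℝ) ^ α := by
    nth_rewrite 2 [← Real.rpow_one (n : ℝ)]
    rw [← Real.rpow_add hn']; congr 1; ring
  have h3 : (⌊(n : ℝ) ^ α⌋₊ : ℝ) ≤ (n : ℝ) ^ α := Nat.floor_le (by positivity)
  rw [h2] at hω
  linarith
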